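/- Let $[v,w]$ denote the determinant of $v,w\in\mathbb R^2$. A (closed) centro-affine curve is a smooth $\Gamma:\mathbb R\to\mathbb R^2$ with $[\Gamma,\Gamma']=1$ and $\Gamma(t+\pi)=-\Gamma(t)$ whose projection $\mathbb R/\pi\mathbb Z\to\mathbb{RP}^1$ is injective (hence a diffeomorphism). Then $\Gamma''=p\,\Gamma$ with a smooth $\pi$-periodic potential $p$. The tangent vectors at $\Gamma$ are the fields $U_f=-\tfrac12 f'\Gamma+f\Gamma'$ with $f$ smooth and $\pi$-periodic. Put $$\omega(U,V)=\int_0^\pi[U,V]\,dt,\qquad \Omega(U,V)=\int_0^\pi\big([U',V']+p\,[U,V]\big)\,dt .$$ The KdV hierarchy consists of the vector fields $X_j=U_{f_j}$, $j\ge 0$, and the Hamiltonians $H_j=\frac1{2j-1}\int_0^\pi f_j\,dt$, $j\ge1$, where the differential polynomials $f_j$ in $p$ are given by $f_0=1$ and $$2f_{n+1}=\sum_{i=0}^{n}\Big(2p f_if_{n-i}+\tfrac12 f_i'f_{n-i}'-f_if_{n-i}''\Big)-\sum_{i=1}^{n}f_if_{n+1-i},$$ so that $X_0=\Gamma'$,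 $X_1=U_p$, $H_1=\int p\,dt$, $H_2=\frac12\int p^2dt$, and so on. For $c\neq0$ and centro-affine curves $\Gamma,\Delta$ write $T_c(\Gamma)=\Delta$ if $[\Gamma(t),\Delta(t)]=c$ for all $t$ ($T_c$ is a partially defined, multivalued map). (0) For every centro-affine curve $\Gamma$ and every $j\ge1$ one has $\Omega(X_{j-1},\cdot)=dH_j=\omega(X_j,\cdot)$ at $\Gamma$, where the differential is taken along smooth families of centro-affine curves. Moreover, for every real $c\ne0$: (1) $T_c$ preserves every $X_j$, $j\ge0$: if $T_c(\Gamma)=\Delta$, then the tangent vectors $U=X_j(\Gamma)$ and $V=X_j(\Delta)$ are related by the differential of $T_c$, that is, $[U,\Delta]+[\Gamma,V]=0$. (2) $T_c$ commutes with the flow of every $X_j$, $j\ge0$: let $\Gamma_s$, $s\in S$ ($S$ an open interval), be a smooth family of centro-affine curves with $\partial_s\Gamma_s=X_j(\Gamma_s)$, let $s_0\in S$ and $T_c(\Gamma_{s_0})=\Delta_0$. Then there is a smooth family $\Delta_s$, $s\in S$, of centro-affine curves with $\Delta_{s_0}=\Delta_0$, $\partial_s\Delta_s=X_j(\Delta_s)$,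 and $T_c(\Gamma_s)=\Delta_s$ for all $s\in S$. Moreover, $\Delta_s$ is the only choice of images $T_c(\Gamma_s)$, $s\in S$, that equals $\Delta_0$ at $s_0$ and is continuous in $s$ for each $t$. (3) $T_c$ preserves every KdV Hamiltonian: if $T_c(\Gamma)=\Delta$, then $H_j(\Delta)=H_j(\Gamma)$ for all $j\ge1$. -/

import Mathlib

open scoped ContDiff

noncomputable section

namespace CentroAffine

/-- The determinant `[v, w]` of two vectors of the plane. -/
def det (v w : ℝ × ℝ) : ℝ := v.1 * w.2 - v.2 * w.1

/-- Closed centro-affine curves: smooth `Γ : ℝ → ℝ²` with `[Γ, Γ'] = 1` and `Γ(t + π) = -Γ(t)`,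
making exactly half a rotation on a period, i.e. the induced map `ℝ/πℤ → ℝP¹`
(a local diffeomorphism, because `[Γ, Γ'] = 1`) is injective, hence a diffeomorphism. -/
structure IsCurve (Γ : ℝ → ℝ × ℝ) : Prop where
  smooth : ContDiff ℝ ∞ Γ
  det_eq_one : ∀ t, det (Γ t) (deriv Γ t) = 1
  antiperiodic : ∀ t, Γ (t + Real.pi) = -Γ t
  simple : ∀ s ∈ Set.Ico 0 Real.pi, ∀ t ∈ Set.Ico 0 Real.pi, det (Γ s) (Γ t) = 0 → s = t

/-- The potential `p` of the Hill equation `Γ'' = p Γ` (see `deriv_deriv_eq`). -/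
def potential (Γ : ℝ → ℝ × ℝ) (t : ℝ) : ℝ := det (deriv (deriv Γ) t) (deriv Γ t)

/-- The tangent vector `U_f = -(1/2) f' Γ + f Γ'`. -/
def tangent (Γ : ℝ → ℝ × ℝ) (f : ℝ → ℝ) (t : ℝ) : ℝ × ℝ :=
  (-(1 / 2) * deriv f t) • Γ t + f t • deriv Γ t

/-- The tangent vectors at `Γ`: the `U_f` with `f` smooth and `π`-periodic. -/
def IsTangent (Γ V : ℝ → ℝ × ℝ) : Prop :=
  ∃ f : ℝ → ℝ, ContDiff ℝ ∞ f ∧ (∀ t, f (t + Real.pi) = f t) ∧ V = tangent Γ f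

/-- The pre-symplectic form `ω(U, V) = ∫ [U, V] dt`. -/
def omega (U V : ℝ → ℝ × ℝ) : ℝ := ∫ t in (0 : ℝ)..Real.pi, det (U t) (V t)

/-- The pre-symplectic form `Ω(U, V) = ∫ ([U', V'] + p [U, V]) dt` at the curve `Γ`. -/
def bigOmega (Γ U V : ℝ → ℝ × ℝ) : ℝ :=
  ∫ t in (0 : ℝ)..Real.pi, (det (deriv U t) (deriv V t) + potential Γ t * det (U t) (V t))

/-- The differential polynomials `f₀ = 1, f₁ = p, f₂ = (3/2) p² - (1/2) p'', …` of the KdV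
hierarchy. They are the solution without integration constants of the Lenard recursion
`f_{n+1}' = -(1/2) f_n''' + 2 p f_n' + p' f_n`; multiplying the recursion for the generating
function `F = ∑ f_n zⁿ` by `F` and integrating once gives
`F² = 1 + z (2 p F² + (1/2) F'² - F F'')`, whose coefficients are the formula below. -/
def kdvPoly (p : ℝ → ℝ) : ℕ → ℝ → ℝ
  | 0 => fun _ => 1
  | n + 1 => fun t =>
      (1 / 2) *
        ((∑ i : Fin (n + 1),
            (2 * p t * kdvPoly p i t * kdvPoly p (n - i) t
              + (1 / 2) * deriv (kdvPoly p i) t * deriv (kdvPoly p (n - i)) t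
              - kdvPoly p i t * deriv (deriv (kdvPoly p (n - i))) t))
          - ∑ i : Fin n, kdvPoly p (i + 1) t * kdvPoly p (n - i) t)
  termination_by n => n
  decreasing_by all_goals omega

/-- The vector fields `X_j = U_{f_j}` of the KdV hierarchy: `X₀ = Γ'`, `X₁ = U_p`, …. -/
def kdvField (j : ℕ) (Γ : ℝ → ℝ × ℝ) : ℝ → ℝ × ℝ := tangent Γ (kdvPoly (potential Γ) j)

/-- The Hamiltonians `H_j = (2j - 1)⁻¹ ∫ f_j dt`, `j ≥ 1`, of the KdV hierarchy:
`H₁ = ∫ p dt`, `H₂ = (1/2) ∫ p² dt`, …. -/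
def kdvHamiltonian (j : ℕ) (Γ : ℝ → ℝ × ℝ) : ℝ :=
  (2 * (j : ℝ) - 1)⁻¹ * ∫ t in (0 : ℝ)..Real.pi, kdvPoly (potential Γ) j t

/-- A smooth family of curves `G s`, `s ∈ S`. -/
structure IsSmoothFamily (S : Set ℝ) (G : ℝ → ℝ → ℝ × ℝ) : Prop where
  smooth : ContDiffOn ℝ ∞ (fun x : ℝ × ℝ => G x.1 x.2) (S ×ˢ Set.univ)
  isCurve : ∀ s ∈ S, IsCurve (G s)

/-- `dH = φ` at `Γ`: along every smooth family of curves through `Γ` with velocity `V`,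
the derivative of `H` is `φ V`. -/
def HasDifferentialAt (H : (ℝ → ℝ × ℝ) → ℝ) (φ : (ℝ → ℝ × ℝ) → ℝ) (Γ : ℝ → ℝ × ℝ) : Prop :=
  ∀ (S : Set ℝ) (G : ℝ → ℝ → ℝ × ℝ), IsOpen S → 0 ∈ S → IsSmoothFamily S G → G 0 = Γ →
    HasDerivAt (fun s => H (G s)) (φ (fun t => deriv (fun s => G s t) 0)) 0

/-- `G` is a trajectory, over the time interval `S`, of the flow of `X_j`:
`∂G/∂s = X_j(G)`. -/
structure IsKdVTrajectory (j : ℕ) (S : Set ℝ) (G : ℝ → ℝ → ℝ × ℝ) : Prop where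
  family : IsSmoothFamily S G
  flow : ∀ s ∈ S, ∀ t, HasDerivAt (fun r => G r t) (kdvField j (G s) t) s

/-- The relation `T_c(Γ) = Δ`: both are centro-affine curves and `[Γ(t), Δ(t)] = c`. -/
structure IsImage (c : ℝ) (Γ Δ : ℝ → ℝ × ℝ) : Prop where
  left : IsCurve Γ
  right : IsCurve Δ
  det_eq : ∀ t, det (Γ t) (Δ t) = c

/-- The tangent vectors `U` at `Γ` and `V` at `Δ` are related by the differential of `T_c`,
i.e. they satisfy the linearization of `[Γ, Δ] = c`. -/
def DifferentialRelated (Γ Δ U V : ℝ → ℝ × ℝ) : Prop :=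
  IsTangent Γ U ∧ IsTangent Δ V ∧ ∀ t, det (U t) (Δ t) + det (Γ t) (V t) = 0

theorem deriv_deriv_eq {Γ : ℝ → ℝ × ℝ} (h : IsCurve Γ) (t : ℝ) :
    deriv (deriv Γ) t = potential Γ t • Γ t := by
  have h1 : HasDerivAt Γ (deriv Γ t) t :=
    (h.smooth.differentiable (by simp) t).hasDerivAt
  have h2 : HasDerivAt (deriv Γ) (deriv (deriv Γ) t) t :=
    (((contDiff_infty_iff_deriv.1 h.smooth).2).differentiable (by simp) t).hasDerivAt
  have e := ((hasFDerivAt_fst.comp_hasDerivAt t h1).mul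
    (hasFDerivAt_snd.comp_hasDerivAt t h2)).sub
    ((hasFDerivAt_snd.comp_hasDerivAt t h1).mul (hasFDerivAt_fst.comp_hasDerivAt t h2))
  have e0 := (hasDerivAt_const t (1 : ℝ)).unique
    (e.congr_of_eventuallyEq (Filter.Eventually.of_forall fun s => (h.det_eq_one s).symm))
  have hd := h.det_eq_one t
  simp only [det, Function.comp, ContinuousLinearMap.coe_fst',
    ContinuousLinearMap.coe_snd'] at e0 hd
  ext
  · simp only [potential, det, Prod.smul_fst, smul_eq_mul]
    linear_combination (-(deriv (deriv Γ) t).1) * hd - (deriv Γ t).1 * e0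
  · simp only [potential, det, Prod.smul_snd, smul_eq_mul]
    linear_combination (-(deriv (deriv Γ) t).2) * hd - (deriv Γ t).2 * e0

theorem kdvPoly_zero (p : ℝ → ℝ) : kdvPoly p 0 = fun _ => 1 := by rw [kdvPoly]

theorem kdvPoly_one (p : ℝ → ℝ) : kdvPoly p 1 = p := by
  ext t
  rw [kdvPoly]
  simp [kdvPoly_zero]

theorem kdvPoly_two (p : ℝ → ℝ) :
    kdvPoly p 2 = fun t => (3 / 2) * p t ^ 2 - (1 / 2) * deriv (deriv p) t := by
  ext t
  rw [kdvPoly]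
  simp [Fin.sum_univ_two, kdvPoly_zero, kdvPoly_one]
  ring

theorem kdvField_zero (Γ : ℝ → ℝ × ℝ) : kdvField 0 Γ = deriv Γ := by
  ext t <;> simp [kdvField, tangent, kdvPoly_zero]

theorem kdvField_one (Γ : ℝ → ℝ × ℝ) : kdvField 1 Γ = tangent Γ (potential Γ) := by
  rw [kdvField, kdvPoly_one]

theorem kdvHamiltonian_one (Γ : ℝ → ℝ × ℝ) :
    kdvHamiltonian 1 Γ = ∫ t in (0 : ℝ)..Real.pi, potential Γ t := by
  rw [kdvHamiltonian, kdvPoly_one]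
  norm_num

end CentroAffine

end

/-!
`T_c` is the Darboux transformation of Hill's equation with spectral parameter `l = 1 / c²`. If
`[Γ, Δ] = c`, then `Δ = c u Γ + c Γ'` for a `π`-periodic function `u` (`slope`), and `[Δ, Δ'] = 1`
is the Riccati equation `u' = u² - l - p` (`IsImage.riccati`), so that the potentials of the two
curves are `p = u² - u' - l` and `q = u² + u' - l`.

The differential polynomials `f_n` are treated through their generating function `F = ∑ f_n zⁿ`, at
each point of the line a power series with real coefficients, which is characterized by the
quadratic identity `F² = 1 + z (2 p F² + (1/2) F'² - F F'')` (`IsQuadratic.eq_kdvPoly`).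
Differentiating the identity gives the Lenard recursion `f_{n+1}' = L f_n` with
`L = -(1/2) ∂³ + 2 p ∂ + p'`.

*The bi-Hamiltonian recursion.* The velocity of a family of curves is a field `U_g`, and it moves
the potential by `L g`. Integration by parts gives `Ω(U_f, U_g) = ∫ f L g`, and, as `L` is skew,
`Ω(X_{j-1}, ·) = ω(X_j, ·)`. That `f_{j-1}` is the gradient of `H_j` follows from the first
variation of the quadratic identity (`variation_identity`), applied to two derivations: the
derivative in the parameter of the family gives `δ ∫ 1/F = -z ∫ F δp`, and the Euler operator
`z d/dz` gives `∫ F = (1 - 2 z d/dz) ∫ 1/F`, i.e. the coefficients of `-∫ 1/F` are the `H_j`.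

*Invariance.* Let `G` be given by `(1 + 2 l z) (G - F) = z (F' + 2 u F)'`. Then
`(F + G)' = 2 u (G - F)`, and `G` satisfies the quadratic identity for `q`, so it is the generating
function for `q` (`kdvPoly_darboux`). The first relation is the invariance of the fields `X_j`; the definition of
`G` shows inductively that `∫ g_n = ∫ f_n`, the invariance of the Hamiltonians.

*The flows.* The slope is `u = -ψ'/ψ` for a positive solution of `ψ'' = (p + l) ψ` that is
multiplied by a constant `μ` under `t ↦ t + π`. Along the flow of `X_j` this equation is compatible
with `∂ψ/∂s = Φ ψ' - (1/2) Φ' ψ`, where `Φ = ∑ (-2 l)ⁱ f_{j-i}` (`laxCoeff`). Both equations are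
linear, so `ψ` exists for all times `s` (`exists_linear_solution`, `hasDerivAt_of_zero_curvature`);
it keeps its multiplier, and it remains positive, because a double zero would have to appear first
(`exists_lax_solution`). The resulting `u` yields the trajectory of the images; that these curves
are simple is `isCurve_of_det_eq`. As for uniqueness, any other periodic solution `v` of the
Riccati equation has `(v(0) - u(0)) ψ(0)² ∫ ψ⁻² = 1 - μ⁻²` (`riccati_periodic_sub`). The right hand
side is independent of `s`, so the left hand side, being continuous in `s` and zero at `s₀`, can
not jump between this value and `0`.
-/

noncomputable section

namespace CentroAffine

open PowerSeries

/-! ### Curves of power series -/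

/-- Coefficientwise derivative of a curve of real power series. -/
def HasSeriesDeriv (F : ℝ → ℝ⟦X⟧) (F' : ℝ⟦X⟧) (t : ℝ) : Prop :=
  ∀ n, HasDerivAt (fun s => coeff n (F s)) (coeff n F') t

namespace HasSeriesDeriv

variable {F G : ℝ → ℝ⟦X⟧} {F' G' : ℝ⟦X⟧} {t : ℝ}

theorem unique (h : HasSeriesDeriv F F' t) (h' : HasSeriesDeriv F G' t) : F' = G' := by
  ext n
  exact (h n).unique (h' n)

theorem add (hF : HasSeriesDeriv F F' t) (hG : HasSeriesDeriv G G' t) :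
    HasSeriesDeriv (fun s => F s + G s) (F' + G') t := fun n => by
  simpa only [map_add] using (hF n).fun_add (hG n)

theorem sub (hF : HasSeriesDeriv F F' t) (hG : HasSeriesDeriv G G' t) :
    HasSeriesDeriv (fun s => F s - G s) (F' - G') t := fun n => by
  simpa only [map_sub] using (hF n).fun_sub (hG n)

theorem mul (hF : HasSeriesDeriv F F' t) (hG : HasSeriesDeriv G G' t) :
    HasSeriesDeriv (fun s => F s * G s) (F' * G t + F t * G') t := fun n => by
  simp only [map_add, coeff_mul, ← Finset.sum_add_distrib]
  exact HasDerivAt.fun_sum fun x _ => (hF x.1).mul (hG x.2)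

theorem const (A : ℝ⟦X⟧) : HasSeriesDeriv (fun _ => A) 0 t := fun n => by
  simpa using hasDerivAt_const t (coeff n A)

theorem C {a : ℝ → ℝ} {a' : ℝ} (h : HasDerivAt a a' t) :
    HasSeriesDeriv (fun s => PowerSeries.C (a s)) (PowerSeries.C a') t := fun n => by
  simp only [coeff_C]
  split_ifs
  · exact h
  · exact hasDerivAt_const t 0

theorem const_mul (A : ℝ⟦X⟧) (hF : HasSeriesDeriv F F' t) :
    HasSeriesDeriv (fun s => A * F s) (A * F') t := by
  simpa using (const A).mul hF

theorem congr_deriv (hF : HasSeriesDeriv F F' t) (h : F' = G') : HasSeriesDeriv F G' t := h ▸ hF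

/-- The coefficients of `F⁻¹` depend differentiably on the parameter, because they are
polynomials in those of `F`, divided by powers of the constant coefficient. -/
theorem inv (hF : HasSeriesDeriv F F' t) (h0 : ∀ s, constantCoeff (F s) = 1) :
    HasSeriesDeriv (fun s => (F s)⁻¹) (-F' * (F t)⁻¹ ^ 2) t := by
  have hmul : ∀ s, F s * (F s)⁻¹ = 1 := fun s => PowerSeries.mul_inv_cancel _ (by simp [h0 s])
  have hdiff : ∀ n, DifferentiableAt ℝ (fun s => coeff n (F s)⁻¹) t := by
    intro n
    induction n using Nat.strong_induction_on with
    | _ n ih =>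
      have e : (fun s => coeff n (F s)⁻¹) = fun s => if n = 0 then 1 else
          -1 * ∑ x ∈ Finset.HasAntidiagonal.antidiagonal n,
            if x.2 < n then coeff x.1 (F s) * coeff x.2 (F s)⁻¹ else 0 := by
        ext s
        rw [coeff_inv, h0 s, inv_one]
      rw [e]
      split_ifs
      · fun_prop
      · refine DifferentiableAt.const_mul ?_ _
        refine DifferentiableAt.fun_sum fun x _ => ?_
        split_ifs with hx
        · exact (hF x.1).differentiableAt.mul (ih _ hx)
        · fun_prop
  have hR : HasSeriesDeriv (fun s => (F s)⁻¹)
      (PowerSeries.mk fun n => deriv (fun s => coeff n (F s)⁻¹) t) t := fun n => by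
    simpa using (hdiff n).hasDerivAt
  have h1 := hF.mul hR
  simp only [hmul] at h1
  have h2 := h1.unique (const 1)
  refine hR.congr_deriv ?_
  linear_combination (F t)⁻¹ * h2
    - (PowerSeries.mk fun n => deriv (fun s => coeff n (F s)⁻¹) t) * hmul t

end HasSeriesDeriv

/-- The generating function `∑ gₙ(t) Xⁿ` of a sequence of functions, at a point. -/
def genSeries (g : ℕ → ℝ → ℝ) (t : ℝ) : ℝ⟦X⟧ := PowerSeries.mk fun n => g n t

@[simp] theorem coeff_genSeries (g : ℕ → ℝ → ℝ) (t : ℝ) (n : ℕ) :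
    coeff n (genSeries g t) = g n t := by simp [genSeries]

theorem genSeries_hasSeriesDeriv {g g' : ℕ → ℝ → ℝ} {t : ℝ}
    (h : ∀ n, HasDerivAt (g n) (g' n t) t) :
    HasSeriesDeriv (genSeries g) (genSeries g' t) t := fun n => by
  simpa using h n

/-! ### Smooth functions of two variables -/

/-- `φ s t` is smooth in `(s, t)` for `s ∈ S`. -/
def SmoothOn {E : Type*} [NormedAddCommGroup E] [NormedSpace ℝ E] (S : Set ℝ)
    (φ : ℝ → ℝ → E) : Prop :=
  ContDiffOn ℝ ∞ (fun x : ℝ × ℝ => φ x.1 x.2) (S ×ˢ Set.univ)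

section SmoothOn

variable {E : Type*} [NormedAddCommGroup E] [NormedSpace ℝ E] {S : Set ℝ} {φ : ℝ → ℝ → E} {s t : ℝ}

theorem isOpen_strip (hS : IsOpen S) : IsOpen (S ×ˢ (Set.univ : Set ℝ)) := hS.prod isOpen_univ

theorem SmoothOn.contDiffAt (hS : IsOpen S) (h : SmoothOn S φ) (hs : s ∈ S) (t : ℝ) :
    ContDiffAt ℝ ∞ (fun x : ℝ × ℝ => φ x.1 x.2) (s, t) :=
  ContDiffOn.contDiffAt h ((isOpen_strip hS).mem_nhds ⟨hs, Set.mem_univ t⟩)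

theorem SmoothOn.hasDerivAt_right (hS : IsOpen S) (h : SmoothOn S φ) (hs : s ∈ S) (t : ℝ) :
    HasDerivAt (φ s) (deriv (φ s) t) t := by
  have h1 : DifferentiableAt ℝ (φ s) t :=
    ((h.contDiffAt hS hs t).differentiableAt (by simp)).comp t
      (f := fun r : ℝ => (s, r)) (by fun_prop)
  exact h1.hasDerivAt

theorem SmoothOn.hasDerivAt_left (hS : IsOpen S) (h : SmoothOn S φ) (hs : s ∈ S) (t : ℝ) :
    HasDerivAt (fun r => φ r t) (deriv (fun r => φ r t) s) s := by
  have h1 : DifferentiableAt ℝ (fun r => φ r t) s :=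
    ((h.contDiffAt hS hs t).differentiableAt (by simp)).comp s
      (f := fun r : ℝ => (r, t)) (by fun_prop)
  exact h1.hasDerivAt

theorem SmoothOn.contDiff_right (hS : IsOpen S) (h : SmoothOn S φ) (hs : s ∈ S) :
    ContDiff ℝ ∞ (φ s) := by
  rw [contDiff_iff_contDiffAt]
  intro t
  exact (h.contDiffAt hS hs t).comp t (f := fun r : ℝ => (s, r)) (by fun_prop)

theorem SmoothOn.deriv_right_eq (hS : IsOpen S) (h : SmoothOn S φ) (hs : s ∈ S) (t : ℝ) :
    deriv (φ s) t = fderiv ℝ (fun x : ℝ × ℝ => φ x.1 x.2) (s, t) (0, 1) := by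
  have h1 := ((h.contDiffAt hS hs t).differentiableAt (by simp)).hasFDerivAt
  have h2 : HasDerivAt (fun r : ℝ => (s, r)) ((0 : ℝ), (1 : ℝ)) t :=
    (hasDerivAt_const t s).prodMk (hasDerivAt_id t)
  exact (h1.comp_hasDerivAt t h2).deriv

theorem SmoothOn.deriv_left_eq (hS : IsOpen S) (h : SmoothOn S φ) (hs : s ∈ S) (t : ℝ) :
    deriv (fun r => φ r t) s = fderiv ℝ (fun x : ℝ × ℝ => φ x.1 x.2) (s, t) (1, 0) := by
  have h1 := ((h.contDiffAt hS hs t).differentiableAt (by simp)).hasFDerivAt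
  have h2 : HasDerivAt (fun r : ℝ => (r, t)) ((1 : ℝ), (0 : ℝ)) s :=
    (hasDerivAt_id s).prodMk (hasDerivAt_const s t)
  exact (h1.comp_hasDerivAt s h2).deriv

theorem SmoothOn.congr {ψ : ℝ → ℝ → E} (h : SmoothOn S φ) (e : ∀ s ∈ S, ∀ t, ψ s t = φ s t) :
    SmoothOn S ψ :=
  ContDiffOn.congr h fun x hx => e x.1 hx.1 x.2

theorem SmoothOn.deriv_right (hS : IsOpen S) (h : SmoothOn S φ) :
    SmoothOn S fun s t => deriv (φ s) t := by
  have h1 : SmoothOn S fun s t => fderiv ℝ (fun x : ℝ × ℝ => φ x.1 x.2) (s, t) (0, 1) :=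
    (ContDiffOn.fderiv_of_isOpen h (isOpen_strip hS) (m := ∞) (by simp)).clm_apply
      contDiffOn_const
  exact h1.congr fun s hs t => h.deriv_right_eq hS hs t

theorem SmoothOn.deriv_left (hS : IsOpen S) (h : SmoothOn S φ) :
    SmoothOn S fun s t => deriv (fun r => φ r t) s := by
  have h1 : SmoothOn S fun s t => fderiv ℝ (fun x : ℝ × ℝ => φ x.1 x.2) (s, t) (1, 0) :=
    (ContDiffOn.fderiv_of_isOpen h (isOpen_strip hS) (m := ∞) (by simp)).clm_apply
      contDiffOn_const
  exact h1.congr fun s hs t => h.deriv_left_eq hS hs t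

/-- Mixed partial derivatives commute. -/
theorem SmoothOn.deriv_comm (hS : IsOpen S) (h : SmoothOn S φ) (hs : s ∈ S) (t : ℝ) :
    deriv (fun τ => deriv (fun r => φ r τ) s) t = deriv (fun r => deriv (φ r) t) s := by
  obtain ⟨f, hf⟩ : ∃ f : ℝ × ℝ → E, f = fun x => φ x.1 x.2 := ⟨_, rfl⟩
  have hc : ContDiffAt ℝ ∞ f (s, t) := hf ▸ h.contDiffAt hS hs t
  have hd : DifferentiableAt ℝ (fderiv ℝ f) (s, t) :=
    (hc.fderiv_right (m := 1) (by norm_cast)).differentiableAt (by simp)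
  have hsym : fderiv ℝ (fderiv ℝ f) (s, t) (0, 1) (1, 0) =
      fderiv ℝ (fderiv ℝ f) (s, t) (1, 0) (0, 1) :=
    hc.isSymmSndFDerivAt (by
      rw [minSmoothness_of_isRCLikeNormedField]
      exact WithTop.coe_le_coe.2 le_top) _ _
  have e1 : (fun τ => deriv (fun r => φ r τ) s) = fun τ => fderiv ℝ f (s, τ) (1, 0) :=
    funext fun τ => by rw [h.deriv_left_eq hS hs τ, hf]
  have e2 : (fun r => deriv (φ r) t) =ᶠ[nhds s] fun r => fderiv ℝ f (r, t) (0, 1) :=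
    Filter.Eventually.mono (hS.mem_nhds hs) fun r hr => by
      simp only [h.deriv_right_eq hS hr t, hf]
  have k1 : HasDerivAt (fun r : ℝ => (s, r)) ((0 : ℝ), (1 : ℝ)) t :=
    (hasDerivAt_const t s).prodMk (hasDerivAt_id t)
  have k2 : HasDerivAt (fun r : ℝ => (r, t)) ((1 : ℝ), (0 : ℝ)) s :=
    (hasDerivAt_id s).prodMk (hasDerivAt_const s t)
  have d1 : HasDerivAt (fun τ => fderiv ℝ f (s, τ) (1, 0))
      (fderiv ℝ (fderiv ℝ f) (s, t) (0, 1) (1, 0)) t := by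
    exact (ContinuousLinearMap.apply ℝ E ((1 : ℝ), (0 : ℝ))).hasFDerivAt.comp_hasDerivAt t
      (hd.hasFDerivAt.comp_hasDerivAt t k1)
  have d2 : HasDerivAt (fun r => fderiv ℝ f (r, t) (0, 1))
      (fderiv ℝ (fderiv ℝ f) (s, t) (1, 0) (0, 1)) s := by
    exact (ContinuousLinearMap.apply ℝ E ((0 : ℝ), (1 : ℝ))).hasFDerivAt.comp_hasDerivAt s
      (hd.hasFDerivAt.comp_hasDerivAt s k2)
  rw [e1, e2.deriv_eq, d1.deriv, d2.deriv, hsym]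

theorem SmoothOn.of_contDiff {f : ℝ → E} (hf : ContDiff ℝ ∞ f) (S : Set ℝ) :
    SmoothOn S fun _ t => f t :=
  (hf.comp contDiff_snd).contDiffOn

end SmoothOn

/-! ### The differential polynomials of the hierarchy -/

theorem kdvPoly_succ (p : ℝ → ℝ) (n : ℕ) (t : ℝ) :
    kdvPoly p (n + 1) t = (1 / 2) *
      ((∑ i : Fin (n + 1),
          (2 * p t * kdvPoly p i t * kdvPoly p (n - i) t
            + (1 / 2) * deriv (kdvPoly p i) t * deriv (kdvPoly p (n - i)) t
            - kdvPoly p i t * deriv (deriv (kdvPoly p (n - i))) t))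
        - ∑ i : Fin n, kdvPoly p (i + 1) t * kdvPoly p (n - i) t) := by
  rw [kdvPoly]

theorem kdvPoly_smoothOn {S : Set ℝ} (hS : IsOpen S) {p : ℝ → ℝ → ℝ} (hp : SmoothOn S p) (n : ℕ) :
    SmoothOn S fun s t => kdvPoly (p s) n t := by
  induction n using Nat.strong_induction_on with
  | _ n ih =>
    cases n with
    | zero =>
      simp only [kdvPoly_zero]
      exact contDiffOn_const
    | succ n =>
      refine SmoothOn.congr ?_ fun s _ t => kdvPoly_succ (p s) n t
      refine ContDiffOn.mul contDiffOn_const (ContDiffOn.sub ?_ ?_)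
      · refine ContDiffOn.sum fun i _ => ?_
        have h1 := ih i (by omega)
        have h2 := ih (n - i) (by omega)
        refine ContDiffOn.sub (ContDiffOn.add ?_ ?_) ?_
        · exact ContDiffOn.mul (ContDiffOn.mul (ContDiffOn.mul contDiffOn_const hp) h1) h2
        · exact ContDiffOn.mul (ContDiffOn.mul contDiffOn_const (h1.deriv_right hS))
            (h2.deriv_right hS)
        · exact ContDiffOn.mul h1 ((h2.deriv_right hS).deriv_right hS)
      · refine ContDiffOn.sum fun i _ => ?_
        exact ContDiffOn.mul (ih (i + 1) (by omega)) (ih (n - i) (by omega))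

theorem kdvPoly_contDiff {p : ℝ → ℝ} (hp : ContDiff ℝ ∞ p) (n : ℕ) : ContDiff ℝ ∞ (kdvPoly p n) :=
  (kdvPoly_smoothOn isOpen_univ (SmoothOn.of_contDiff hp Set.univ) n).contDiff_right isOpen_univ
    (Set.mem_univ 0)

/-- The quadratic identity `F² = 1 + z (2 p F² + (1/2) F'² - F F'')` for the generating function of
a sequence of functions. -/
def IsQuadratic (p : ℝ → ℝ) (g : ℕ → ℝ → ℝ) : Prop :=
  ∀ t, genSeries g t ^ 2 = 1 + X * (C (2 * p t) * genSeries g t ^ 2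
    + C (1 / 2) * genSeries (fun n => deriv (g n)) t ^ 2
    - genSeries g t * genSeries (fun n => deriv (deriv (g n))) t)

theorem isQuadratic_iff {p : ℝ → ℝ} {g : ℕ → ℝ → ℝ} (h0 : g 0 = fun _ => 1) :
    IsQuadratic p g ↔ ∀ n t, g (n + 1) t = (1 / 2) *
        ((∑ i : Fin (n + 1),
            (2 * p t * g i t * g (n - i) t
              + (1 / 2) * deriv (g i) t * deriv (g (n - i)) t
              - g i t * deriv (deriv (g (n - i))) t))
          - ∑ i : Fin n, g (i + 1) t * g (n - i) t) := by
  rw [IsQuadratic, forall_comm]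
  refine forall_congr' fun t => ?_
  rw [PowerSeries.ext_iff]
  have key : ∀ n, (coeff (n + 1) (genSeries g t ^ 2) = coeff (n + 1) (1 + X * (C (2 * p t) *
      genSeries g t ^ 2 + C (1 / 2) * genSeries (fun n => deriv (g n)) t ^ 2
        - genSeries g t * genSeries (fun n => deriv (deriv (g n))) t)) ↔
      g (n + 1) t = (1 / 2) *
        ((∑ i : Fin (n + 1),
            (2 * p t * g i t * g (n - i) t
              + (1 / 2) * deriv (g i) t * deriv (g (n - i)) t
              - g i t * deriv (deriv (g (n - i))) t))
          - ∑ i : Fin n, g (i + 1) t * g (n - i) t)) := by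
    intro n
    have hL : coeff (n + 1) (genSeries g t ^ 2)
        = 2 * g (n + 1) t + ∑ i : Fin n, g (i + 1) t * g (n - i) t := by
      rw [sq, coeff_mul, Finset.Nat.sum_antidiagonal_eq_sum_range_succ_mk, Finset.sum_range_succ,
        Finset.sum_range_succ', Finset.sum_range]
      simp only [coeff_genSeries, h0, Nat.add_sub_add_right, Nat.sub_zero, Nat.sub_self]
      ring
    have hR : coeff (n + 1) (1 + X * (C (2 * p t) *
        genSeries g t ^ 2 + C (1 / 2) * genSeries (fun n => deriv (g n)) t ^ 2
        - genSeries g t * genSeries (fun n => deriv (deriv (g n))) t))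
        = ∑ i : Fin (n + 1), (2 * p t * g i t * g (n - i) t
              + (1 / 2) * deriv (g i) t * deriv (g (n - i)) t
              - g i t * deriv (deriv (g (n - i))) t) := by
      rw [map_add, coeff_succ_X_mul, map_sub, map_add, coeff_C_mul, coeff_C_mul, sq, sq, coeff_mul,
        coeff_mul, coeff_mul]
      simp only [coeff_genSeries, Finset.Nat.sum_antidiagonal_eq_sum_range_succ_mk, coeff_one,
        Finset.sum_range, Finset.sum_add_distrib, Finset.sum_sub_distrib, mul_assoc,
        ← Finset.mul_sum]
      simp
    rw [hL, hR]
    constructor <;> intro h <;> linarith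
  constructor
  · intro h n
    exact (key n).1 (h (n + 1))
  · intro h n
    cases n with
    | zero => simp [sq, coeff_mul, h0]
    | succ n => exact (key n).2 (h n)

theorem kdvPoly_isQuadratic (p : ℝ → ℝ) : IsQuadratic p (kdvPoly p) := by
  rw [isQuadratic_iff (kdvPoly_zero p)]
  intro n t
  rw [kdvPoly_succ]

/-- The quadratic identity determines the sequence. -/
theorem IsQuadratic.eq_kdvPoly {p : ℝ → ℝ} {g : ℕ → ℝ → ℝ} (h : IsQuadratic p g)
    (h0 : g 0 = fun _ => 1) (n : ℕ) : g n = kdvPoly p n := by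
  rw [isQuadratic_iff h0] at h
  induction n using Nat.strong_induction_on with
  | _ n ih =>
    cases n with
    | zero => rw [h0, kdvPoly_zero]
    | succ n =>
      ext t
      rw [h, kdvPoly_succ]
      congr 1
      congr 1
      · refine Finset.sum_congr rfl fun i _ => ?_
        rw [ih i (by omega), ih (n - i) (by omega)]
      · refine Finset.sum_congr rfl fun i _ => ?_
        rw [ih (i + 1) (by omega), ih (n - i) (by omega)]

theorem hasDerivAt_of_contDiff {E : Type*} [NormedAddCommGroup E] [NormedSpace ℝ E] {f : ℝ → E}
    (hf : ContDiff ℝ ∞ f) (t : ℝ) : HasDerivAt f (deriv f t) t :=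
  (hf.differentiable (by simp) t).hasDerivAt

theorem contDiff_deriv {E : Type*} [NormedAddCommGroup E] [NormedSpace ℝ E] {f : ℝ → E}
    (hf : ContDiff ℝ ∞ f) : ContDiff ℝ ∞ (deriv f) :=
  (contDiff_infty_iff_deriv.1 hf).2

/-- The Lenard recursion for the generating function: differentiate the quadratic identity and
divide by `F`. -/
theorem IsQuadratic.lenard {p : ℝ → ℝ} {g : ℕ → ℝ → ℝ} (h : IsQuadratic p g)
    (h0 : g 0 = fun _ => 1) (hp : ContDiff ℝ ∞ p) (hg : ∀ n, ContDiff ℝ ∞ (g n)) (t : ℝ) :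
    2 * genSeries (fun n => deriv (g n)) t = X * (C (2 * deriv p t) * genSeries g t
      + C (4 * p t) * genSeries (fun n => deriv (g n)) t
      - genSeries (fun n => deriv (deriv (deriv (g n)))) t) := by
  have d0 : HasSeriesDeriv (genSeries g) _ t :=
    genSeries_hasSeriesDeriv (g' := fun n => deriv (g n)) fun n => hasDerivAt_of_contDiff (hg n) t
  have d1 : HasSeriesDeriv (genSeries fun n => deriv (g n)) _ t :=
    genSeries_hasSeriesDeriv (g' := fun n => deriv (deriv (g n)))
      fun n => hasDerivAt_of_contDiff (contDiff_deriv (hg n)) t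
  have d2 : HasSeriesDeriv (genSeries fun n => deriv (deriv (g n))) _ t :=
    genSeries_hasSeriesDeriv (g' := fun n => deriv (deriv (deriv (g n))))
      fun n => hasDerivAt_of_contDiff (contDiff_deriv (contDiff_deriv (hg n))) t
  have dp : HasSeriesDeriv (fun t => C (2 * p t)) (C (2 * deriv p t)) t :=
    HasSeriesDeriv.C ((hasDerivAt_of_contDiff hp t).const_mul 2)
  have e1 := d0.mul d0
  have e2 := (HasSeriesDeriv.const 1).add (((dp.mul (d0.mul d0)).add
    ((d1.mul d1).const_mul (C (1 / 2)))).sub (d0.mul d2) |>.const_mul X)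
  have e3 : (fun t => genSeries g t * genSeries g t) = fun s => 1 + X * (C (2 * p s) *
      (genSeries g s * genSeries g s) + C (1 / 2) * (genSeries (fun n => deriv (g n)) s *
        genSeries (fun n => deriv (g n)) s)
      - genSeries g s * genSeries (fun n => deriv (deriv (g n))) s) := by
    ext1 s
    linear_combination h s
  rw [e3] at e1
  have e4 := e1.unique e2
  have hF : genSeries g t ≠ 0 := fun hz => by
    have := congrArg (coeff 0) hz
    rw [coeff_genSeries, h0] at this
    simp at this
  have c1 : (C (2 * p t) : ℝ⟦X⟧) = 2 * C (p t) := by rw [map_mul]; rfl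
  have c2 : (C (2 * deriv p t) : ℝ⟦X⟧) = 2 * C (deriv p t) := by rw [map_mul]; rfl
  have c3 : (C (4 * p t) : ℝ⟦X⟧) = 4 * C (p t) := by rw [map_mul]; rfl
  have c4 : (2 : ℝ⟦X⟧) * C (1 / 2) = 1 := by
    rw [show (2 : ℝ⟦X⟧) = C 2 from rfl, ← map_mul]; norm_num
  refine mul_left_cancel₀ hF ?_
  rw [c1, c2] at e4
  rw [c2, c3]
  linear_combination e4 + X * genSeries (fun n => deriv (g n)) t *
    genSeries (fun n => deriv (deriv (g n))) t * c4

/-- The operator `L = -(1/2) ∂³ + 2 p ∂ + p'` of the Lenard recursion. -/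
def lenard (p f : ℝ → ℝ) (t : ℝ) : ℝ :=
  -(1 / 2) * deriv (deriv (deriv f)) t + 2 * p t * deriv f t + deriv p t * f t

/-- The Lenard recursion `f_{n+1}' = L f_n`. -/
theorem deriv_kdvPoly_succ {p : ℝ → ℝ} (hp : ContDiff ℝ ∞ p) (n : ℕ) (t : ℝ) :
    deriv (kdvPoly p (n + 1)) t = lenard p (kdvPoly p n) t := by
  have h := congrArg (coeff (n + 1)) ((kdvPoly_isQuadratic p).lenard (kdvPoly_zero p) hp
    (kdvPoly_contDiff hp) t)
  rw [show (2 : ℝ⟦X⟧) = C 2 from rfl] at h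
  simp only [coeff_succ_X_mul, map_add, map_sub, coeff_C_mul, coeff_genSeries] at h
  rw [lenard]
  linarith

theorem deriv_periodic {f : ℝ → ℝ} {T : ℝ} (hf : ∀ t, f (t + T) = f t) (t : ℝ) :
    deriv f (t + T) = deriv f t := by
  rw [← deriv_comp_add_const]
  simp only [hf]

theorem kdvPoly_periodic {p : ℝ → ℝ} {T : ℝ} (hp : ∀ t, p (t + T) = p t) (n : ℕ) (t : ℝ) :
    kdvPoly p n (t + T) = kdvPoly p n t := by
  induction n using Nat.strong_induction_on generalizing t with
  | _ n ih =>
    cases n with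
    | zero => simp [kdvPoly_zero]
    | succ n =>
      have h (i : ℕ) (hi : i ≤ n) : ∀ t, kdvPoly p i (t + T) = kdvPoly p i t := ih i (by omega)
      rw [kdvPoly_succ, kdvPoly_succ, hp]
      congr 1
      congr 1
      · refine Finset.sum_congr rfl fun i _ => ?_
        have hi := h i (by omega)
        have hj := h (n - i) (by omega)
        rw [hi, hj, deriv_periodic hi, deriv_periodic hj, deriv_periodic (deriv_periodic hj)]
      · refine Finset.sum_congr rfl fun i _ => ?_
        rw [h (i + 1) (by omega), h (n - i) (by omega)]

/-! ### Calculus of centro-affine curves -/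

theorem det_hasDerivAt {f g : ℝ → ℝ × ℝ} {f' g' : ℝ × ℝ} {t : ℝ} (hf : HasDerivAt f f' t)
    (hg : HasDerivAt g g' t) :
    HasDerivAt (fun s => det (f s) (g s)) (det f' (g t) + det (f t) g') t := by
  have hf1 : HasDerivAt (fun s => (f s).1) f'.1 t :=
    (ContinuousLinearMap.fst ℝ ℝ ℝ).hasFDerivAt.comp_hasDerivAt t hf
  have hf2 : HasDerivAt (fun s => (f s).2) f'.2 t :=
    (ContinuousLinearMap.snd ℝ ℝ ℝ).hasFDerivAt.comp_hasDerivAt t hf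
  have hg1 : HasDerivAt (fun s => (g s).1) g'.1 t :=
    (ContinuousLinearMap.fst ℝ ℝ ℝ).hasFDerivAt.comp_hasDerivAt t hg
  have hg2 : HasDerivAt (fun s => (g s).2) g'.2 t :=
    (ContinuousLinearMap.snd ℝ ℝ ℝ).hasFDerivAt.comp_hasDerivAt t hg
  refine ((hf1.fun_mul hg2).fun_sub (hf2.fun_mul hg1)).congr_deriv ?_
  simp only [det]
  ring

theorem contDiffOn_det {E : Type*} [NormedAddCommGroup E] [NormedSpace ℝ E] {s : Set E}
    {f g : E → ℝ × ℝ} (hf : ContDiffOn ℝ ∞ f s) (hg : ContDiffOn ℝ ∞ g s) :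
    ContDiffOn ℝ ∞ (fun x => det (f x) (g x)) s :=
  (hf.fst.mul hg.snd).sub (hf.snd.mul hg.fst)

theorem SmoothOn.det {S : Set ℝ} {φ ψ : ℝ → ℝ → ℝ × ℝ} (hφ : SmoothOn S φ) (hψ : SmoothOn S ψ) :
    SmoothOn S fun s t => det (φ s t) (ψ s t) :=
  contDiffOn_det hφ hψ

theorem contDiff_det {f g : ℝ → ℝ × ℝ} (hf : ContDiff ℝ ∞ f) (hg : ContDiff ℝ ∞ g) :
    ContDiff ℝ ∞ fun t => det (f t) (g t) :=
  contDiffOn_univ.1 (contDiffOn_det hf.contDiffOn hg.contDiffOn)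

/-- Cramer's rule. -/
theorem eq_of_det_eq_one {a b : ℝ × ℝ} (h : det a b = 1) (v : ℝ × ℝ) :
    v = det v b • a + det a v • b := by
  simp only [det] at *
  ext
  · simp only [Prod.fst_add, Prod.smul_fst, smul_eq_mul]
    linear_combination (-v.1) * h
  · simp only [Prod.snd_add, Prod.smul_snd, smul_eq_mul]
    linear_combination (-v.2) * h

theorem deriv_antiperiodic {f : ℝ → ℝ × ℝ} {T : ℝ} (hf : ∀ t, f (t + T) = -f t) (t : ℝ) :
    deriv f (t + T) = -deriv f t := by
  rw [← deriv_comp_add_const, ← deriv.fun_neg]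
  simp only [hf]

theorem det_neg_neg (v w : ℝ × ℝ) : det (-v) (-w) = det v w := by
  simp [det]

theorem IsCurve.smooth_deriv {Γ : ℝ → ℝ × ℝ} (h : IsCurve Γ) : ContDiff ℝ ∞ (deriv Γ) :=
  contDiff_deriv h.smooth

theorem IsCurve.hasDerivAt {Γ : ℝ → ℝ × ℝ} (h : IsCurve Γ) (t : ℝ) :
    HasDerivAt Γ (deriv Γ t) t := hasDerivAt_of_contDiff h.smooth t

theorem IsCurve.hasDerivAt_deriv {Γ : ℝ → ℝ × ℝ} (h : IsCurve Γ) (t : ℝ) :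
    HasDerivAt (deriv Γ) (potential Γ t • Γ t) t :=
  deriv_deriv_eq h t ▸ hasDerivAt_of_contDiff h.smooth_deriv t

theorem IsCurve.contDiff_potential {Γ : ℝ → ℝ × ℝ} (h : IsCurve Γ) : ContDiff ℝ ∞ (potential Γ) :=
  contDiff_det (contDiff_deriv h.smooth_deriv) h.smooth_deriv

theorem IsCurve.potential_periodic {Γ : ℝ → ℝ × ℝ} (h : IsCurve Γ) (t : ℝ) :
    potential Γ (t + Real.pi) = potential Γ t := by
  rw [potential, deriv_antiperiodic (deriv_antiperiodic h.antiperiodic),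
    deriv_antiperiodic h.antiperiodic, det_neg_neg, potential]

theorem IsCurve.kdvPoly_contDiff {Γ : ℝ → ℝ × ℝ} (h : IsCurve Γ) (n : ℕ) :
    ContDiff ℝ ∞ (kdvPoly (potential Γ) n) :=
  CentroAffine.kdvPoly_contDiff h.contDiff_potential n

theorem IsCurve.isTangent_kdvField {Γ : ℝ → ℝ × ℝ} (h : IsCurve Γ) (n : ℕ) :
    IsTangent Γ (kdvField n Γ) :=
  ⟨_, h.kdvPoly_contDiff n, kdvPoly_periodic h.potential_periodic n, rfl⟩

theorem IsCurve.hasDerivAt_tangent {Γ : ℝ → ℝ × ℝ} (h : IsCurve Γ) {f : ℝ → ℝ}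
    (hf : ContDiff ℝ ∞ f) (t : ℝ) :
    HasDerivAt (tangent Γ f) ((-(1 / 2) * deriv (deriv f) t + potential Γ t * f t) • Γ t
      + ((1 / 2) * deriv f t) • deriv Γ t) t := by
  have h1 := (((hasDerivAt_of_contDiff (contDiff_deriv hf) t).const_mul (-(1 / 2) : ℝ)).fun_smul
    (h.hasDerivAt t)).fun_add ((hasDerivAt_of_contDiff hf t).fun_smul (h.hasDerivAt_deriv t))
  refine h1.congr_deriv ?_
  module

theorem IsCurve.deriv_tangent {Γ : ℝ → ℝ × ℝ} (h : IsCurve Γ) {f : ℝ → ℝ} (hf : ContDiff ℝ ∞ f) :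
    deriv (tangent Γ f) = fun t => (-(1 / 2) * deriv (deriv f) t + potential Γ t * f t) • Γ t
      + ((1 / 2) * deriv f t) • deriv Γ t :=
  funext fun t => (h.hasDerivAt_tangent hf t).deriv

theorem IsCurve.deriv_deriv_tangent {Γ : ℝ → ℝ × ℝ} (h : IsCurve Γ) {f : ℝ → ℝ}
    (hf : ContDiff ℝ ∞ f) (t : ℝ) :
    deriv (deriv (tangent Γ f)) t =
      (-(1 / 2) * deriv (deriv (deriv f)) t + deriv (potential Γ) t * f t
        + (3 / 2) * potential Γ t * deriv f t) • Γ t + (potential Γ t * f t) • deriv Γ t := by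
  have h1 := ((((hasDerivAt_of_contDiff (contDiff_deriv (contDiff_deriv hf)) t).const_mul
    (-(1 / 2) : ℝ)).fun_add ((hasDerivAt_of_contDiff h.contDiff_potential t).fun_mul
      (hasDerivAt_of_contDiff hf t))).fun_smul (h.hasDerivAt t)).fun_add
    (((hasDerivAt_of_contDiff (contDiff_deriv hf) t).const_mul (1 / 2 : ℝ)).fun_smul
      (h.hasDerivAt_deriv t))
  rw [h.deriv_tangent hf, h1.deriv]
  module

theorem det_combination {a b : ℝ × ℝ} (h : det a b = 1) (x y z w : ℝ) :
    det (x • a + y • b) (z • a + w • b) = x * w - y * z := by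
  simp only [det, Prod.fst_add, Prod.snd_add, Prod.smul_fst, Prod.smul_snd, smul_eq_mul] at *
  linear_combination (x * w - y * z) * h

theorem integral_eq_zero_of_hasDerivAt {h h' : ℝ → ℝ} (hd : ∀ t, HasDerivAt h (h' t) t)
    (hc : Continuous h') (hper : ∀ t, h (t + Real.pi) = h t) :
    ∫ t in (0 : ℝ)..Real.pi, h' t = 0 := by
  rw [intervalIntegral.integral_eq_sub_of_hasDerivAt (fun t _ => hd t)
    (hc.intervalIntegrable _ _), ← hper 0, zero_add, sub_self]

/-! ### The two pre-symplectic forms -/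

theorem IsCurve.bigOmega_tangent {Γ : ℝ → ℝ × ℝ} (h : IsCurve Γ) {f g : ℝ → ℝ}
    (hf : ContDiff ℝ ∞ f) (hg : ContDiff ℝ ∞ g) :
    bigOmega Γ (tangent Γ f) (tangent Γ g) = ∫ t in (0 : ℝ)..Real.pi,
      (-(1 / 4) * deriv (deriv f) t * deriv g t + (1 / 4) * deriv f t * deriv (deriv g) t
        + potential Γ t * (f t * deriv g t - deriv f t * g t)) := by
  refine intervalIntegral.integral_congr fun t _ => ?_
  simp only [h.deriv_tangent hf, h.deriv_tangent hg, tangent,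
    det_combination (h.det_eq_one t)]
  ring

theorem IsCurve.omega_tangent {Γ : ℝ → ℝ × ℝ} (h : IsCurve Γ) (f g : ℝ → ℝ) :
    omega (tangent Γ f) (tangent Γ g) = ∫ t in (0 : ℝ)..Real.pi,
      (1 / 2) * (f t * deriv g t - deriv f t * g t) := by
  refine intervalIntegral.integral_congr fun t _ => ?_
  simp only [tangent, det_combination (h.det_eq_one t)]
  ring

/-- The Lenard recursion intertwines the two forms: `Ω(U_f, ·) = ω(U_k, ·)` if `k' = L f`. -/
theorem IsCurve.bigOmega_eq_omega {Γ : ℝ → ℝ × ℝ} (h : IsCurve Γ) {f k g : ℝ → ℝ}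
    (hf : ContDiff ℝ ∞ f) (hk : ContDiff ℝ ∞ k) (hg : ContDiff ℝ ∞ g)
    (pf : ∀ t, f (t + Real.pi) = f t) (pk : ∀ t, k (t + Real.pi) = k t)
    (pg : ∀ t, g (t + Real.pi) = g t) (hL : ∀ t, deriv k t = lenard (potential Γ) f t) :
    bigOmega Γ (tangent Γ f) (tangent Γ g) = omega (tangent Γ k) (tangent Γ g) := by
  have hp := h.contDiff_potential
  have f1 := contDiff_deriv hf
  have f2 := contDiff_deriv f1
  have g1 := contDiff_deriv hg
  have g2 := contDiff_deriv g1
  have k1 := contDiff_deriv hk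
  rw [h.bigOmega_tangent hf hg, h.omega_tangent, ← sub_eq_zero,
    ← intervalIntegral.integral_sub]
  · refine integral_eq_zero_of_hasDerivAt (h := fun t => potential Γ t * f t * g t
      + (1 / 4) * (deriv f t * deriv g t) - (1 / 2) * (deriv (deriv f) t * g t)
      - (1 / 2) * (k t * g t)) (fun t => ?_) ?_ fun t => ?_
    · have dp := hasDerivAt_of_contDiff hp t
      have df := hasDerivAt_of_contDiff hf t
      have df1 := hasDerivAt_of_contDiff f1 t
      have df2 := hasDerivAt_of_contDiff f2 t
      have dg := hasDerivAt_of_contDiff hg t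
      have dg1 := hasDerivAt_of_contDiff g1 t
      have dk := hasDerivAt_of_contDiff hk t
      refine (((((dp.fun_mul df).fun_mul dg).fun_add ((df1.fun_mul dg1).const_mul (1 / 4))).fun_sub
        ((df2.fun_mul dg).const_mul (1 / 2))).fun_sub
          ((dk.fun_mul dg).const_mul (1 / 2))).congr_deriv ?_
      simp only [hL, lenard]
      ring
    · have := hp.continuous
      have := hf.continuous
      have := f1.continuous
      have := f2.continuous
      have := hg.continuous
      have := g1.continuous
      have := g2.continuous
      have := hk.continuous
      have := k1.continuous
      fun_prop
    · simp only [h.potential_periodic, pf, pg, pk, deriv_periodic pf, deriv_periodic pg,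
        deriv_periodic (deriv_periodic pf)]
  · have := hp.continuous
    have := hf.continuous
    have := f1.continuous
    have := f2.continuous
    have := hg.continuous
    have := g1.continuous
    have := g2.continuous
    exact Continuous.intervalIntegrable (by fun_prop) _ _
  · have := hg.continuous
    have := g1.continuous
    have := hk.continuous
    have := k1.continuous
    exact Continuous.intervalIntegrable (by fun_prop) _ _

/-- `Ω` in terms of the operator `L`, by integration by parts. -/
theorem IsCurve.bigOmega_eq_integral_lenard {Γ : ℝ → ℝ × ℝ} (h : IsCurve Γ) {f g : ℝ → ℝ}
    (hf : ContDiff ℝ ∞ f) (hg : ContDiff ℝ ∞ g)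
    (pf : ∀ t, f (t + Real.pi) = f t) (pg : ∀ t, g (t + Real.pi) = g t) :
    bigOmega Γ (tangent Γ f) (tangent Γ g) =
      ∫ t in (0 : ℝ)..Real.pi, f t * lenard (potential Γ) g t := by
  have hp := h.contDiff_potential
  have f1 := contDiff_deriv hf
  have f2 := contDiff_deriv f1
  have g1 := contDiff_deriv hg
  have g2 := contDiff_deriv g1
  have := hp.continuous
  have := (contDiff_deriv hp).continuous
  have := hf.continuous
  have := f1.continuous
  have := f2.continuous
  have := hg.continuous
  have := g1.continuous
  have := g2.continuous
  have := (contDiff_deriv g2).continuous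
  rw [h.bigOmega_tangent hf hg, eq_comm, ← sub_eq_zero, ← intervalIntegral.integral_sub]
  · refine integral_eq_zero_of_hasDerivAt (h := fun t => potential Γ t * f t * g t
      + (1 / 4) * (deriv f t * deriv g t) - (1 / 2) * (f t * deriv (deriv g) t))
      (fun t => ?_) ?_ fun t => ?_
    · have dp := hasDerivAt_of_contDiff hp t
      have df := hasDerivAt_of_contDiff hf t
      have df1 := hasDerivAt_of_contDiff f1 t
      have dg := hasDerivAt_of_contDiff hg t
      have dg1 := hasDerivAt_of_contDiff g1 t
      have dg2 := hasDerivAt_of_contDiff g2 t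
      refine ((((dp.fun_mul df).fun_mul dg).fun_add ((df1.fun_mul dg1).const_mul (1 / 4))).fun_sub
        ((df.fun_mul dg2).const_mul (1 / 2))).congr_deriv ?_
      simp only [lenard]
      ring
    · unfold lenard
      fun_prop
    · simp only [h.potential_periodic, pf, pg, deriv_periodic pf, deriv_periodic pg,
        deriv_periodic (deriv_periodic pg)]
  · unfold lenard
    exact Continuous.intervalIntegrable (by fun_prop) _ _
  · exact Continuous.intervalIntegrable (by fun_prop) _ _

/-! ### The gradients of the Hamiltonians -/

theorem hasDerivAt_intervalIntegral {S : Set ℝ} (hS : IsOpen S) {φ : ℝ → ℝ → ℝ}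
    (h : SmoothOn S φ) {s : ℝ} (hs : s ∈ S) (a b : ℝ) :
    HasDerivAt (fun r => ∫ t in a..b, φ r t) (∫ t in a..b, deriv (fun r => φ r t) s) s := by
  obtain ⟨ε, hε, hball⟩ := Metric.nhds_basis_closedBall.mem_iff.1 (hS.mem_nhds hs)
  have hd := h.deriv_left hS
  have hK : IsCompact (Metric.closedBall s ε ×ˢ Set.uIcc a b) :=
    (isCompact_closedBall s ε).prod isCompact_uIcc
  obtain ⟨M, hM⟩ := hK.exists_bound_of_continuousOn
    ((ContDiffOn.continuousOn hd).mono fun x hx => ⟨hball hx.1, Set.mem_univ _⟩)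
  have hc : ∀ r ∈ S, Continuous (φ r) := fun r hr => (h.contDiff_right hS hr).continuous
  refine (intervalIntegral.hasDerivAt_integral_of_dominated_loc_of_deriv_le
    (bound := fun _ => M) (Metric.closedBall_mem_nhds s hε)
    (Filter.Eventually.mono (hS.mem_nhds hs) fun r hr => (hc r hr).aestronglyMeasurable)
    ((hc s hs).intervalIntegrable _ _)
    (hd.contDiff_right hS hs).continuous.aestronglyMeasurable
    (Filter.Eventually.of_forall fun t ht r hr => hM (r, t) ⟨hr, Set.uIoc_subset_uIcc ht⟩)
    (continuous_const.intervalIntegrable _ _)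
    (Filter.Eventually.of_forall fun t _ r hr => h.hasDerivAt_left hS (hball hr) t)).2

/-- The Euler operator `z d/dz` on power series. -/
def euler : Derivation ℝ ℝ⟦X⟧ ℝ⟦X⟧ := (X : ℝ⟦X⟧) • PowerSeries.derivative ℝ

theorem coeff_euler (F : ℝ⟦X⟧) (n : ℕ) : coeff n (euler F) = n * coeff n F := by
  have h : euler F = X * PowerSeries.derivative ℝ F := rfl
  rw [h]
  cases n with
  | zero => simp
  | succ n => rw [coeff_succ_X_mul, coeff_derivative]; push_cast; ring

theorem HasSeriesDeriv.euler {F : ℝ → ℝ⟦X⟧} {F' : ℝ⟦X⟧} {t : ℝ} (h : HasSeriesDeriv F F' t) :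
    HasSeriesDeriv (fun s => euler (F s)) (CentroAffine.euler F') t := fun n => by
  simp only [coeff_euler]
  exact (h n).const_mul _

/-- The first variation of the quadratic identity, in a form that exhibits the total derivative.
Here `F1, F2` stand for `F', F''`, `R` for `1/F`, and the letter `d` for any derivation (which may
move the variable `z` of the generating function); the left hand side is `z w'` for
`w = dF' - F' R dF = F d(F'/F)`. -/
theorem variation_identity {A : Type*} [CommRing A] {F F1 F2 R P z half dF dF1 dF2 dP dz : A}
    (hR : F * R = 1) (hhalf : 2 * half = 1)
    (hquad : F ^ 2 = 1 + z * (2 * P * F ^ 2 + half * F1 ^ 2 - F * F2))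
    (hvar : 2 * F * dF = dz * (2 * P * F ^ 2 + half * F1 ^ 2 - F * F2)
      + z * (2 * dP * F ^ 2 + 4 * P * F * dF + F1 * dF1 - dF * F2 - F * dF2)) :
    z * (dF2 - (F2 * R - F1 * F1 * R ^ 2) * dF - F1 * R * dF1) =
      R * dz * (2 * P * F ^ 2 + half * F1 ^ 2 - F * F2) + 2 * z * dP * F - 2 * R ^ 2 * dF := by
  linear_combination R * hvar - 2 * R ^ 2 * dF * hquad
    + (-z * dF2 + 2 * z * dP * F + dF * (2 * F * R - 4 * z * P * F * R + 2 * z * F2 * R)) * hR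
    - z * F1 ^ 2 * R ^ 2 * dF * hhalf

theorem two_mul_C_half : (2 : ℝ⟦X⟧) * C (1 / 2) = 1 := by
  rw [show (2 : ℝ⟦X⟧) = C 2 from rfl, ← map_mul]
  norm_num

theorem C_two_mul (a : ℝ) : (C (2 * a) : ℝ⟦X⟧) = 2 * C a := by
  rw [map_mul]
  rfl

theorem constantCoeff_kdv (p : ℝ → ℝ) (t : ℝ) :
    constantCoeff (genSeries (kdvPoly p) t) = 1 := by
  rw [← coeff_zero_eq_constantCoeff_apply, coeff_genSeries, kdvPoly_zero]

theorem kdv_mul_inv (p : ℝ → ℝ) (t : ℝ) :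
    genSeries (kdvPoly p) t * (genSeries (kdvPoly p) t)⁻¹ = 1 :=
  PowerSeries.mul_inv_cancel _ (by simp [constantCoeff_kdv])

/-- The coefficients of `1 / F`, where `F` is the generating function of the hierarchy; up to
sign and total derivatives these are the densities of the Hamiltonians. -/
def invCoeff (p : ℝ → ℝ) (n : ℕ) (t : ℝ) : ℝ := coeff n (genSeries (kdvPoly p) t)⁻¹

theorem invCoeff_eq (p : ℝ → ℝ) (n : ℕ) (t : ℝ) :
    invCoeff p n t = if n = 0 then 1 else -∑ x ∈ Finset.HasAntidiagonal.antidiagonal n,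
      if x.2 < n then kdvPoly p x.1 t * invCoeff p x.2 t else 0 := by
  rw [invCoeff, coeff_inv, constantCoeff_kdv, inv_one]
  simp only [coeff_genSeries, neg_mul, one_mul, invCoeff]

theorem invCoeff_smoothOn {S : Set ℝ} (hS : IsOpen S) {p : ℝ → ℝ → ℝ} (hp : SmoothOn S p)
    (n : ℕ) : SmoothOn S fun s t => invCoeff (p s) n t := by
  induction n using Nat.strong_induction_on with
  | _ n ih =>
    refine SmoothOn.congr ?_ fun s _ t => invCoeff_eq (p s) n t
    split_ifs
    · exact contDiffOn_const
    · refine ContDiffOn.neg (ContDiffOn.sum fun x _ => ?_)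
      split_ifs with hx
      · exact ContDiffOn.mul (kdvPoly_smoothOn hS hp x.1) (ih x.2 hx)
      · exact contDiffOn_const

theorem invCoeff_contDiff {p : ℝ → ℝ} (hp : ContDiff ℝ ∞ p) (n : ℕ) :
    ContDiff ℝ ∞ (invCoeff p n) :=
  (invCoeff_smoothOn isOpen_univ (SmoothOn.of_contDiff hp Set.univ) n).contDiff_right isOpen_univ
    (Set.mem_univ 0)

theorem hasSeriesDeriv_kdv {p : ℝ → ℝ} (hp : ContDiff ℝ ∞ p) (t : ℝ) :
    HasSeriesDeriv (genSeries (kdvPoly p)) (genSeries (fun n => deriv (kdvPoly p n)) t) t :=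
  genSeries_hasSeriesDeriv fun n => hasDerivAt_of_contDiff (kdvPoly_contDiff hp n) t

theorem hasSeriesDeriv_kdv_deriv {p : ℝ → ℝ} (hp : ContDiff ℝ ∞ p) (t : ℝ) :
    HasSeriesDeriv (genSeries fun n => deriv (kdvPoly p n))
      (genSeries (fun n => deriv (deriv (kdvPoly p n))) t) t :=
  genSeries_hasSeriesDeriv
    fun n => hasDerivAt_of_contDiff (contDiff_deriv (kdvPoly_contDiff hp n)) t

theorem hasSeriesDeriv_kdv_inv {p : ℝ → ℝ} (hp : ContDiff ℝ ∞ p) (t : ℝ) :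
    HasSeriesDeriv (fun s => (genSeries (kdvPoly p) s)⁻¹)
      (-genSeries (fun n => deriv (kdvPoly p n)) t * (genSeries (kdvPoly p) t)⁻¹ ^ 2) t :=
  (hasSeriesDeriv_kdv hp t).inv (constantCoeff_kdv p)

theorem genSeries_congr {g g' : ℕ → ℝ → ℝ} {t t' : ℝ} (h : ∀ n, g n t = g' n t') :
    genSeries g t = genSeries g' t' := by
  ext n
  simpa using h n

theorem genSeries_kdv_periodic {p : ℝ → ℝ} {T : ℝ} (hp : ∀ t, p (t + T) = p t) (t : ℝ) :
    genSeries (kdvPoly p) (t + T) = genSeries (kdvPoly p) t :=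
  genSeries_congr fun n => kdvPoly_periodic hp n t

theorem genSeries_kdv_deriv_periodic {p : ℝ → ℝ} {T : ℝ} (hp : ∀ t, p (t + T) = p t) (t : ℝ) :
    genSeries (fun n => deriv (kdvPoly p n)) (t + T) =
      genSeries (fun n => deriv (kdvPoly p n)) t :=
  genSeries_congr fun n => deriv_periodic (kdvPoly_periodic hp n) t

/-- Scaling: `∫ F = (1 - 2 z d/dz) ∫ 1/F`. -/
theorem integral_kdvPoly_eq {p : ℝ → ℝ} (hp : ContDiff ℝ ∞ p)
    (pp : ∀ t, p (t + Real.pi) = p t) (n : ℕ) :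
    ∫ t in (0 : ℝ)..Real.pi, kdvPoly p (n + 1) t =
      (1 - 2 * ((n : ℝ) + 1)) * ∫ t in (0 : ℝ)..Real.pi, invCoeff p (n + 1) t := by
  have hf := kdvPoly_contDiff hp (n + 1)
  have hr := invCoeff_contDiff hp (n + 1)
  have cm : Continuous fun t => (1 - 2 * ((n : ℝ) + 1)) * invCoeff p (n + 1) t :=
    continuous_const.mul hr.continuous
  rw [← sub_eq_zero, ← intervalIntegral.integral_const_mul, ← intervalIntegral.integral_sub
    (hf.continuous.intervalIntegrable _ _) (cm.intervalIntegrable _ _)]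
  refine integral_eq_zero_of_hasDerivAt
    (h := fun t => coeff n (euler (genSeries (fun n => deriv (kdvPoly p n)) t)
      - genSeries (fun n => deriv (kdvPoly p n)) t * (genSeries (kdvPoly p) t)⁻¹
        * euler (genSeries (kdvPoly p) t))) (fun t => ?_)
    (hf.continuous.sub cm) fun t => by
      simp only [genSeries_kdv_periodic pp, genSeries_kdv_deriv_periodic pp]
  have hF := hasSeriesDeriv_kdv hp t
  have hF1 := hasSeriesDeriv_kdv_deriv hp t
  have hR := hasSeriesDeriv_kdv_inv hp t
  have hw := hF1.euler.sub ((hF1.mul hR).mul hF.euler)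
  refine (hw n).congr_deriv ?_
  rw [← coeff_succ_X_mul]
  have hinv := kdv_mul_inv p t
  have hquad := kdvPoly_isQuadratic p t
  rw [C_two_mul] at hquad
  have hvar := congrArg euler hquad
  have euler_X : euler (X : ℝ⟦X⟧) = X := by simp [euler]
  have euler_C (a : ℝ) : euler (C a : ℝ⟦X⟧) = 0 := by simp [euler]
  have euler_two : euler (2 : ℝ⟦X⟧) = 0 := euler_C 2
  have euler_inv := congrArg euler hinv
  simp only [Derivation.leibniz, Derivation.map_one_eq_zero, map_add, map_sub,
    Derivation.leibniz_pow, smul_eq_mul, nsmul_eq_mul, euler_X, euler_C, euler_two,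
    Nat.cast_ofNat, Nat.add_one_sub_one, pow_one] at hvar euler_inv
  have hid := variation_identity (z := X) (dz := X) (dP := 0) hinv two_mul_C_half hquad
    (dF := euler (genSeries (kdvPoly p) t))
    (dF1 := euler (genSeries (fun n => deriv (kdvPoly p n)) t))
    (dF2 := euler (genSeries (fun n => deriv (deriv (kdvPoly p n))) t))
    (by linear_combination hvar + X * genSeries (fun n => deriv (kdvPoly p n)) t
          * euler (genSeries (fun n => deriv (kdvPoly p n)) t) * two_mul_C_half)
  have hfin : X * (euler (genSeries (fun n => deriv (deriv (kdvPoly p n))) t)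
      - ((genSeries (fun n => deriv (deriv (kdvPoly p n))) t * (genSeries (kdvPoly p) t)⁻¹
        + genSeries (fun n => deriv (kdvPoly p n)) t *
          (-genSeries (fun n => deriv (kdvPoly p n)) t * (genSeries (kdvPoly p) t)⁻¹ ^ 2))
          * euler (genSeries (kdvPoly p) t)
        + genSeries (fun n => deriv (kdvPoly p n)) t * (genSeries (kdvPoly p) t)⁻¹
          * euler (genSeries (fun n => deriv (kdvPoly p n)) t)))
      = genSeries (kdvPoly p) t - (genSeries (kdvPoly p) t)⁻¹
        + 2 * euler (genSeries (kdvPoly p) t)⁻¹ := by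
    linear_combination hid - (genSeries (kdvPoly p) t)⁻¹ * hquad
      + (genSeries (kdvPoly p) t + 2 * euler (genSeries (kdvPoly p) t)⁻¹) * hinv
      - 2 * (genSeries (kdvPoly p) t)⁻¹ * euler_inv
  rw [hfin, show (2 : ℝ⟦X⟧) = C 2 from rfl, map_add, map_sub, coeff_C_mul, coeff_euler,
    coeff_genSeries, invCoeff]
  push_cast
  ring

section Variation

variable {S : Set ℝ} {p : ℝ → ℝ → ℝ} {s : ℝ}

/-- First variation of `∫ 1/F`: it equals `-z ∫ (∂p/∂s) F`. -/
theorem integral_deriv_invCoeff (hS : IsOpen S) (hp : SmoothOn S p)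
    (pp : ∀ s ∈ S, ∀ t, p s (t + Real.pi) = p s t) (hs : s ∈ S) (n : ℕ) :
    ∫ t in (0 : ℝ)..Real.pi, deriv (fun r => invCoeff (p r) (n + 1) t) s =
      -∫ t in (0 : ℝ)..Real.pi, kdvPoly (p s) n t * deriv (fun r => p r t) s := by
  have hf (n : ℕ) := kdvPoly_smoothOn hS hp n
  have hr := invCoeff_smoothOn hS hp (n + 1)
  have hps := hp.contDiff_right hS hs
  have c1 := ((hr.deriv_left hS).contDiff_right hS hs).continuous
  have c2 := ((hf n).contDiff_right hS hs).continuous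
  have c3 := ((hp.deriv_left hS).contDiff_right hS hs).continuous
  have cm : Continuous fun t => kdvPoly (p s) n t * deriv (fun r => p r t) s := c2.mul c3
  rw [← sub_eq_zero, sub_neg_eq_add, ← intervalIntegral.integral_add
    (c1.intervalIntegrable _ _) (cm.intervalIntegrable _ _)]
  have hev : ∀ᶠ r in nhds s, r ∈ S := hS.mem_nhds hs
  have perF (n : ℕ) (t : ℝ) : deriv (fun r => kdvPoly (p r) n (t + Real.pi)) s =
      deriv (fun r => kdvPoly (p r) n t) s :=
    Filter.EventuallyEq.deriv_eq (hev.mono fun r hr => kdvPoly_periodic (pp r hr) n t)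
  have perF1 (n : ℕ) (t : ℝ) : deriv (fun r => deriv (kdvPoly (p r) n) (t + Real.pi)) s =
      deriv (fun r => deriv (kdvPoly (p r) n) t) s :=
    Filter.EventuallyEq.deriv_eq
      (hev.mono fun r hr => deriv_periodic (kdvPoly_periodic (pp r hr) n) t)
  refine integral_eq_zero_of_hasDerivAt
    (h := fun t => (1 / 2) * coeff n
      (genSeries (fun n t => deriv (fun r => deriv (kdvPoly (p r) n) t) s) t
        - genSeries (fun n => deriv (kdvPoly (p s) n)) t * (genSeries (kdvPoly (p s)) t)⁻¹
        * genSeries (fun n t => deriv (fun r => kdvPoly (p r) n t) s) t))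
    (fun t => ?_) (c1.add cm) fun t => ?_
  · have hF := hasSeriesDeriv_kdv hps t
    have hF1 := hasSeriesDeriv_kdv_deriv hps t
    have hR := hasSeriesDeriv_kdv_inv hps t
    have hdF : HasSeriesDeriv (genSeries (fun n t => deriv (fun r => kdvPoly (p r) n t) s))
        (genSeries (fun n t => deriv (fun r => deriv (kdvPoly (p r) n) t) s) t) t :=
      genSeries_hasSeriesDeriv fun n => by
        rw [← (hf n).deriv_comm hS hs t]
        exact ((hf n).deriv_left hS).hasDerivAt_right hS hs t
    have hdF1 : HasSeriesDeriv (genSeries (fun n t => deriv (fun r => deriv (kdvPoly (p r) n) t) s))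
        (genSeries (fun n t => deriv (fun r => deriv (deriv (kdvPoly (p r) n)) t) s) t) t :=
      genSeries_hasSeriesDeriv fun n => by
        rw [← ((hf n).deriv_right hS).deriv_comm hS hs t]
        exact (((hf n).deriv_right hS).deriv_left hS).hasDerivAt_right hS hs t
    have hw := hdF1.sub ((hF1.mul hR).mul hdF)
    refine ((hw n).const_mul (1 / 2)).congr_deriv ?_
    rw [← coeff_succ_X_mul]
    have hinv := kdv_mul_inv (p s) t
    have hquad := kdvPoly_isQuadratic (p s) t
    rw [C_two_mul] at hquad
    -- the same generating functions, as functions of the parameter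
    have sF : HasSeriesDeriv (fun r => genSeries (kdvPoly (p r)) t)
        (genSeries (fun n t => deriv (fun r => kdvPoly (p r) n t) s) t) s := fun n => by
      simpa using (hf n).hasDerivAt_left hS hs t
    have sF1 : HasSeriesDeriv (fun r => genSeries (fun n => deriv (kdvPoly (p r) n)) t)
        (genSeries (fun n t => deriv (fun r => deriv (kdvPoly (p r) n) t) s) t) s := fun n => by
      simpa using ((hf n).deriv_right hS).hasDerivAt_left hS hs t
    have sF2 : HasSeriesDeriv (fun r => genSeries (fun n => deriv (deriv (kdvPoly (p r) n))) t)
        (genSeries (fun n t => deriv (fun r => deriv (deriv (kdvPoly (p r) n)) t) s) t) s :=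
      fun n => by
        simpa using (((hf n).deriv_right hS).deriv_right hS).hasDerivAt_left hS hs t
    have sR : deriv (fun r => invCoeff (p r) (n + 1) t) s = coeff (n + 1)
        (-genSeries (fun n t => deriv (fun r => kdvPoly (p r) n t) s) t
          * (genSeries (kdvPoly (p s)) t)⁻¹ ^ 2) :=
      ((sF.inv fun r => constantCoeff_kdv (p r) t) (n + 1)).deriv
    have sp : HasSeriesDeriv (fun r => C (2 * p r t)) (C (2 * deriv (fun r => p r t) s)) s :=
      HasSeriesDeriv.C ((hp.hasDerivAt_left hS hs t).const_mul 2)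
    have e1 := sF.mul sF
    have e2 := (HasSeriesDeriv.const 1).add (((sp.mul (sF.mul sF)).add
      ((sF1.mul sF1).const_mul (C (1 / 2)))).sub (sF.mul sF2) |>.const_mul X)
    have e3 : (fun r => genSeries (kdvPoly (p r)) t * genSeries (kdvPoly (p r)) t) = fun r =>
        1 + X * (C (2 * p r t) * (genSeries (kdvPoly (p r)) t * genSeries (kdvPoly (p r)) t)
          + C (1 / 2) * (genSeries (fun n => deriv (kdvPoly (p r) n)) t
            * genSeries (fun n => deriv (kdvPoly (p r) n)) t)
          - genSeries (kdvPoly (p r)) t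
            * genSeries (fun n => deriv (deriv (kdvPoly (p r) n))) t) := by
      ext1 r
      linear_combination kdvPoly_isQuadratic (p r) t
    rw [e3] at e1
    have hvar := e1.unique e2
    rw [C_two_mul, C_two_mul] at hvar
    have hid := variation_identity (z := X) (dz := 0) (dP := C (deriv (fun r => p r t) s)) hinv
      two_mul_C_half hquad
      (dF := genSeries (fun n t => deriv (fun r => kdvPoly (p r) n t) s) t)
      (dF1 := genSeries (fun n t => deriv (fun r => deriv (kdvPoly (p r) n) t) s) t)
      (dF2 := genSeries (fun n t => deriv (fun r => deriv (deriv (kdvPoly (p r) n)) t) s) t)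
      (by linear_combination hvar + X * genSeries (fun n => deriv (kdvPoly (p s) n)) t
            * genSeries (fun n t => deriv (fun r => deriv (kdvPoly (p r) n) t) s) t
            * two_mul_C_half)
    have hfin : X * (genSeries (fun n t => deriv (fun r => deriv (deriv (kdvPoly (p r) n)) t) s) t
        - ((genSeries (fun n => deriv (deriv (kdvPoly (p s) n))) t
            * (genSeries (kdvPoly (p s)) t)⁻¹
          + genSeries (fun n => deriv (kdvPoly (p s) n)) t *
            (-genSeries (fun n => deriv (kdvPoly (p s) n)) t
              * (genSeries (kdvPoly (p s)) t)⁻¹ ^ 2))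
            * genSeries (fun n t => deriv (fun r => kdvPoly (p r) n t) s) t
          + genSeries (fun n => deriv (kdvPoly (p s) n)) t * (genSeries (kdvPoly (p s)) t)⁻¹
            * genSeries (fun n t => deriv (fun r => deriv (kdvPoly (p r) n) t) s) t))
        = C 2 * (X * (C (deriv (fun r => p r t) s) * genSeries (kdvPoly (p s)) t)
          + -genSeries (fun n t => deriv (fun r => kdvPoly (p r) n t) s) t
          * (genSeries (kdvPoly (p s)) t)⁻¹ ^ 2) := by
      rw [show (C 2 : ℝ⟦X⟧) = 2 from rfl]
      linear_combination hid
    rw [hfin, coeff_C_mul, map_add, ← sR, coeff_succ_X_mul, coeff_C_mul, coeff_genSeries]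
    ring
  · simp only [genSeries_kdv_periodic (pp s hs), genSeries_kdv_deriv_periodic (pp s hs)]
    have e0 : genSeries (fun n t => deriv (fun r => kdvPoly (p r) n t) s) (t + Real.pi) =
        genSeries (fun n t => deriv (fun r => kdvPoly (p r) n t) s) t :=
      genSeries_congr (perF · t)
    have e1 : genSeries (fun n t => deriv (fun r => deriv (kdvPoly (p r) n) t) s) (t + Real.pi) =
        genSeries (fun n t => deriv (fun r => deriv (kdvPoly (p r) n) t) s) t :=
      genSeries_congr (perF1 · t)
    rw [e0, e1]

/-- The gradient of `H_{n+1} = (2n+1)⁻¹ ∫ f_{n+1}` with respect to `p` is `f_n`. -/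
theorem hasDerivAt_hamiltonian (hS : IsOpen S) (hp : SmoothOn S p)
    (pp : ∀ s ∈ S, ∀ t, p s (t + Real.pi) = p s t) (hs : s ∈ S) (n : ℕ) :
    HasDerivAt (fun r => (2 * ((n + 1 : ℕ) : ℝ) - 1)⁻¹ *
      ∫ t in (0 : ℝ)..Real.pi, kdvPoly (p r) (n + 1) t)
      (∫ t in (0 : ℝ)..Real.pi, kdvPoly (p s) n t * deriv (fun r => p r t) s) s := by
  have h := (hasDerivAt_intervalIntegral hS (invCoeff_smoothOn hS hp (n + 1)) hs 0 Real.pi).fun_neg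
  rw [integral_deriv_invCoeff hS hp pp hs, neg_neg] at h
  refine h.congr_of_eventuallyEq (Filter.Eventually.mono (hS.mem_nhds hs) fun r hr => ?_)
  have hne : (2 * (n : ℝ) + 1) ≠ 0 := by positivity
  dsimp only
  rw [integral_kdvPoly_eq (hp.contDiff_right hS hr) (pp r hr)]
  have e1 : 2 * ((n + 1 : ℕ) : ℝ) - 1 = 2 * n + 1 := by push_cast; ring
  have e2 : (1 - 2 * ((n : ℝ) + 1)) = -(2 * n + 1) := by ring
  rw [e1, e2]
  field_simp

end Variation

/-- The velocity of a smooth family of curves is tangent, and moves the potential by `L`. -/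
theorem IsSmoothFamily.velocity {S : Set ℝ} {G : ℝ → ℝ → ℝ × ℝ} (hS : IsOpen S)
    (h : IsSmoothFamily S G) {s : ℝ} (hs : s ∈ S) :
    ∃ g : ℝ → ℝ, ContDiff ℝ ∞ g ∧ (∀ t, g (t + Real.pi) = g t) ∧
      (fun t => deriv (fun r => G r t) s) = tangent (G s) g ∧
      ∀ t, deriv (fun r => potential (G r) t) s = lenard (potential (G s)) g t := by
  have hG : SmoothOn S G := h.smooth
  have hΓ := h.isCurve s hs
  obtain ⟨V, hV⟩ : ∃ V : ℝ → ℝ × ℝ, V = fun t => deriv (fun r => G r t) s := ⟨_, rfl⟩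
  have sV : ContDiff ℝ ∞ V := hV ▸ (hG.deriv_left hS).contDiff_right hS hs
  have hev : ∀ᶠ r in nhds s, r ∈ S := hS.mem_nhds hs
  have sg : ContDiff ℝ ∞ fun t => det (G s t) (V t) := contDiff_det hΓ.smooth sV
  have dG (t : ℝ) : HasDerivAt (fun r => G r t) (V t) s := by
    rw [hV]
    exact hG.hasDerivAt_left hS hs t
  have dG1 (t : ℝ) : HasDerivAt (fun r => deriv (G r) t) (deriv V t) s := by
    have := (hG.deriv_right hS).hasDerivAt_left hS hs t
    rwa [← hG.deriv_comm hS hs t, ← hV] at this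
  have dG2 (t : ℝ) : HasDerivAt (fun r => deriv (deriv (G r)) t) (deriv (deriv V) t) s := by
    have := ((hG.deriv_right hS).deriv_right hS).hasDerivAt_left hS hs t
    rwa [← (hG.deriv_right hS).deriv_comm hS hs t, show (fun τ => deriv (fun r => deriv (G r) τ) s)
      = deriv V from funext fun τ => (dG1 τ).deriv] at this
  have hdet (t : ℝ) : det (V t) (deriv (G s) t) + det (G s t) (deriv V t) = 0 :=
    (det_hasDerivAt (dG t) (dG1 t)).unique ((hasDerivAt_const s (1 : ℝ)).congr_of_eventuallyEq
      (hev.mono fun r hr => (h.isCurve r hr).det_eq_one t))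
  have dg (t : ℝ) : deriv (fun t => det (G s t) (V t)) t = -2 * det (V t) (deriv (G s) t) := by
    rw [(det_hasDerivAt (hΓ.hasDerivAt t) (hasDerivAt_of_contDiff sV t)).deriv]
    have := hdet t
    simp only [det] at *
    linarith
  have hVg : V = tangent (G s) fun t => det (G s t) (V t) := by
    ext1 t
    rw [tangent, dg]
    convert eq_of_det_eq_one (hΓ.det_eq_one t) (V t) using 3
    ring
  refine ⟨fun t => det (G s t) (V t), sg, fun t => ?_, hV ▸ hVg, fun t => ?_⟩
  · have e : V (t + Real.pi) = -V t := by
      rw [← (dG t).fun_neg.deriv, ← (dG (t + Real.pi)).deriv]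
      exact Filter.EventuallyEq.deriv_eq (hev.mono fun r hr => (h.isCurve r hr).antiperiodic t)
    simp only [hΓ.antiperiodic, e, det_neg_neg]
  · obtain ⟨g, hg⟩ : ∃ g : ℝ → ℝ, g = fun t => det (G s t) (V t) := ⟨_, rfl⟩
    rw [← hg] at hVg sg ⊢
    have e := (det_hasDerivAt (dG2 t) (dG1 t)).deriv
    rw [hVg, hΓ.deriv_deriv_tangent sg, hΓ.deriv_tangent sg, deriv_deriv_eq hΓ] at e
    refine Eq.trans e ?_
    have h1 := hΓ.det_eq_one t
    simp only [lenard, det, Prod.fst_add, Prod.snd_add, Prod.smul_fst, Prod.smul_snd,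
      smul_eq_mul] at *
    linear_combination (-(1 / 2) * deriv (deriv (deriv g)) t + deriv (potential (G s)) t * g t
      + 2 * potential (G s) t * deriv g t) * h1

theorem IsSmoothFamily.smoothOn_potential {S : Set ℝ} {G : ℝ → ℝ → ℝ × ℝ} (hS : IsOpen S)
    (h : IsSmoothFamily S G) : SmoothOn S fun s => potential (G s) := by
  have hG : SmoothOn S G := h.smooth
  exact ((hG.deriv_right hS).deriv_right hS).det (hG.deriv_right hS)

/-- `dH_j = Ω(X_{j-1}, ·)`: both sides are `∫ f_{j-1} L g` on the field `U_g`. -/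
theorem hasDifferentialAt_hamiltonian {Γ : ℝ → ℝ × ℝ} (h : IsCurve Γ) (n : ℕ) :
    HasDifferentialAt (kdvHamiltonian (n + 1)) (bigOmega Γ (kdvField n Γ)) Γ := by
  rintro S G hS h0 hG rfl
  obtain ⟨g, sg, pg, hV, hp⟩ := hG.velocity hS h0
  rw [hV, kdvField, h.bigOmega_eq_integral_lenard (h.kdvPoly_contDiff n) sg
    (kdvPoly_periodic h.potential_periodic n) pg]
  simp only [← hp]
  exact hasDerivAt_hamiltonian hS (hG.smoothOn_potential hS)
    (fun s hs => (hG.isCurve s hs).potential_periodic) h0 n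

theorem bigOmega_kdvField_eq_omega {Γ V : ℝ → ℝ × ℝ} (h : IsCurve Γ) (n : ℕ)
    (hV : IsTangent Γ V) :
    bigOmega Γ (kdvField n Γ) V = omega (kdvField (n + 1) Γ) V := by
  obtain ⟨g, sg, pg, rfl⟩ := hV
  exact h.bigOmega_eq_omega (h.kdvPoly_contDiff n) (h.kdvPoly_contDiff (n + 1)) sg
    (kdvPoly_periodic h.potential_periodic n) (kdvPoly_periodic h.potential_periodic (n + 1)) pg
    (deriv_kdvPoly_succ h.contDiff_potential n)

/-! ### The Darboux transformation of the hierarchy -/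

/-- The sequence obtained from the hierarchy of `p` by the Darboux transformation with slope `u` and
spectral parameter `l`: its generating function `G` is given by
`(1 + 2 l z) (G - F) = z (F' + 2 u F)'`. -/
def darbouxSeq (p u : ℝ → ℝ) (l : ℝ) : ℕ → ℝ → ℝ
  | 0 => fun _ => 1
  | n + 1 => fun t => kdvPoly p (n + 1) t
      + (deriv (deriv (kdvPoly p n)) t + 2 * u t * deriv (kdvPoly p n) t
        + 2 * deriv u t * kdvPoly p n t)
      - 2 * l * (darbouxSeq p u l n t - kdvPoly p n t)

section Darboux

variable {p q u : ℝ → ℝ} {l : ℝ}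

theorem darbouxSeq_contDiff (hp : ContDiff ℝ ∞ p) (hu : ContDiff ℝ ∞ u) (n : ℕ) :
    ContDiff ℝ ∞ (darbouxSeq p u l n) := by
  induction n with
  | zero => exact contDiff_const
  | succ n ih =>
    have h0 := kdvPoly_contDiff hp n
    exact ((kdvPoly_contDiff hp (n + 1)).add (((contDiff_deriv (contDiff_deriv h0)).add
      ((contDiff_const.mul hu).mul (contDiff_deriv h0))).add
        ((contDiff_const.mul (contDiff_deriv hu)).mul h0))).sub (contDiff_const.mul (ih.sub h0))

theorem darbouxSeq_genSeries (p u : ℝ → ℝ) (l t : ℝ) :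
    (1 + 2 * C l * X) * (genSeries (darbouxSeq p u l) t - genSeries (kdvPoly p) t) =
      X * (genSeries (fun n => deriv (deriv (kdvPoly p n))) t
        + 2 * C (u t) * genSeries (fun n => deriv (kdvPoly p n)) t
        + 2 * C (deriv u t) * genSeries (kdvPoly p) t) := by
  have e : (1 + 2 * C l * X) * (genSeries (darbouxSeq p u l) t - genSeries (kdvPoly p) t) =
      (genSeries (darbouxSeq p u l) t - genSeries (kdvPoly p) t)
        + X * (C (2 * l) * (genSeries (darbouxSeq p u l) t - genSeries (kdvPoly p) t)) := by
    rw [C_two_mul]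
    ring
  rw [e, ← C_two_mul, ← C_two_mul]
  ext n
  cases n with
  | zero =>
    rw [map_add, coeff_zero_X_mul, coeff_zero_X_mul, map_sub, coeff_genSeries, coeff_genSeries,
      kdvPoly_zero, darbouxSeq]
    norm_num
  | succ n =>
    rw [map_add, coeff_succ_X_mul, coeff_succ_X_mul]
    simp only [map_add, map_sub, coeff_C_mul, coeff_genSeries, darbouxSeq]
    ring

theorem one_add_X_ne_zero (l : ℝ) : (1 + 2 * C l * X : ℝ⟦X⟧) ≠ 0 := fun h => by
  have := congrArg constantCoeff h
  simp at this

/-- `G' = 2 u (G - F) - F'`; this uses the Lenard recursion for `F`. -/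
theorem darbouxSeq_deriv_genSeries (hu : ContDiff ℝ ∞ u)
    (hp : p = fun t => u t ^ 2 - deriv u t - l) (t : ℝ) :
    genSeries (fun n => deriv (darbouxSeq p u l n)) t =
      2 * C (u t) * (genSeries (darbouxSeq p u l) t - genSeries (kdvPoly p) t)
        - genSeries (fun n => deriv (kdvPoly p n)) t := by
  have hu1 := contDiff_deriv hu
  have sp : ContDiff ℝ ∞ p := hp ▸ ((hu.pow 2).sub hu1).sub contDiff_const
  have hp1 : deriv p t = 2 * u t * deriv u t - deriv (deriv u) t := by
    have := (((hasDerivAt_of_contDiff hu t).fun_pow 2).fun_sub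
      (hasDerivAt_of_contDiff hu1 t)).sub_const l
    rw [hp, this.deriv]
    ring
  have hp0 : p t = u t ^ 2 - deriv u t - l := by rw [hp]
  have hF := hasSeriesDeriv_kdv sp t
  have hF1 := hasSeriesDeriv_kdv_deriv sp t
  have hF2 : HasSeriesDeriv (genSeries fun n => deriv (deriv (kdvPoly p n)))
      (genSeries (fun n => deriv (deriv (deriv (kdvPoly p n)))) t) t :=
    genSeries_hasSeriesDeriv fun n =>
      hasDerivAt_of_contDiff (contDiff_deriv (contDiff_deriv (kdvPoly_contDiff sp n))) t
  have hG : HasSeriesDeriv (genSeries (darbouxSeq p u l))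
      (genSeries (fun n => deriv (darbouxSeq p u l n)) t) t :=
    genSeries_hasSeriesDeriv fun n => hasDerivAt_of_contDiff (darbouxSeq_contDiff sp hu n) t
  have cu : HasSeriesDeriv (fun t => 2 * C (u t)) (2 * C (deriv u t)) t :=
    (HasSeriesDeriv.C (hasDerivAt_of_contDiff hu t)).const_mul 2
  have cu1 : HasSeriesDeriv (fun t => 2 * C (deriv u t)) (2 * C (deriv (deriv u) t)) t :=
    (HasSeriesDeriv.C (hasDerivAt_of_contDiff hu1 t)).const_mul 2
  have e1 := (hG.sub hF).const_mul (1 + 2 * C l * X)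
  have e2 := ((hF2.add (cu.mul hF1)).add (cu1.mul hF)).const_mul X
  simp only [darbouxSeq_genSeries] at e1
  have e3 := e1.unique e2
  have e4 := (kdvPoly_isQuadratic p).lenard (kdvPoly_zero p) sp (kdvPoly_contDiff sp) t
  have e5 := darbouxSeq_genSeries p u l t
  have c4 : (C (4 * p t) : ℝ⟦X⟧) = 4 * C (p t) := by rw [map_mul]; rfl
  rw [C_two_mul, c4, hp0, hp1] at e4
  simp only [map_sub, map_mul, map_pow, show (C 2 : ℝ⟦X⟧) = 2 from rfl] at e4
  refine mul_left_cancel₀ (one_add_X_ne_zero l) ?_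
  linear_combination e3 + e4 - 2 * C (u t) * e5

/-- The Darboux transformation of the hierarchy is the hierarchy of the transformed potential,
because its generating function satisfies the quadratic identity. -/
theorem kdvPoly_darboux (hu : ContDiff ℝ ∞ u) (hp : p = fun t => u t ^ 2 - deriv u t - l)
    (hq : q = fun t => u t ^ 2 + deriv u t - l) (n : ℕ) :
    kdvPoly q n = darbouxSeq p u l n := by
  have hu1 := contDiff_deriv hu
  have sp : ContDiff ℝ ∞ p := hp ▸ ((hu.pow 2).sub hu1).sub contDiff_const
  refine (IsQuadratic.eq_kdvPoly (fun t => ?_) (by rw [darbouxSeq]) n).symm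
  have hF := hasSeriesDeriv_kdv sp t
  have hF1 := hasSeriesDeriv_kdv_deriv sp t
  have hG : HasSeriesDeriv (genSeries (darbouxSeq p u l))
      (genSeries (fun n => deriv (darbouxSeq p u l n)) t) t :=
    genSeries_hasSeriesDeriv fun n => hasDerivAt_of_contDiff (darbouxSeq_contDiff sp hu n) t
  have hG1 : HasSeriesDeriv (genSeries fun n => deriv (darbouxSeq p u l n))
      (genSeries (fun n => deriv (deriv (darbouxSeq p u l n))) t) t :=
    genSeries_hasSeriesDeriv
      fun n => hasDerivAt_of_contDiff (contDiff_deriv (darbouxSeq_contDiff sp hu n)) t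
  have cu : HasSeriesDeriv (fun t => 2 * C (u t)) (2 * C (deriv u t)) t :=
    (HasSeriesDeriv.C (hasDerivAt_of_contDiff hu t)).const_mul 2
  have e1 := darbouxSeq_deriv_genSeries hu hp t
  have e2 : genSeries (fun n => deriv (deriv (darbouxSeq p u l n))) t = _ :=
    hG1.unique (((cu.mul (hG.sub hF)).sub hF1).congr_deriv rfl |> fun h => by
      rwa [show (genSeries fun n => deriv (darbouxSeq p u l n)) = _ from
        funext (darbouxSeq_deriv_genSeries hu hp)])
  have e3 := darbouxSeq_genSeries p u l t
  have e4 := kdvPoly_isQuadratic p t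
  have hp0 : p t = u t ^ 2 - deriv u t - l := by rw [hp]
  have hq0 : q t = u t ^ 2 + deriv u t - l := by rw [hq]
  rw [C_two_mul, hp0] at e4
  rw [C_two_mul, hq0, e2, e1]
  simp only [map_sub, map_add, map_pow] at e4 ⊢
  linear_combination e4 + (genSeries (darbouxSeq p u l) t + genSeries (kdvPoly p) t) * e3
    + X * (2 * C (u t) ^ 2 * (genSeries (darbouxSeq p u l) t - genSeries (kdvPoly p) t) ^ 2
      - 2 * C (u t) * (genSeries (darbouxSeq p u l) t - genSeries (kdvPoly p) t)
        * genSeries (fun n => deriv (kdvPoly p n)) t) * (-two_mul_C_half)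

/-- The infinitesimal form of the invariance of the hierarchy: `(f + g)' = 2 u (g - f)`. -/
theorem deriv_kdvPoly_darboux (hu : ContDiff ℝ ∞ u) (hp : p = fun t => u t ^ 2 - deriv u t - l)
    (hq : q = fun t => u t ^ 2 + deriv u t - l) (n : ℕ) (t : ℝ) :
    deriv (kdvPoly q n) t =
      2 * u t * (kdvPoly q n t - kdvPoly p n t) - deriv (kdvPoly p n) t := by
  have h := congrArg (coeff n) (darbouxSeq_deriv_genSeries hu hp t)
  rw [← C_two_mul] at h
  simp only [map_sub, coeff_C_mul, coeff_genSeries] at h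
  rw [kdvPoly_darboux hu hp hq, h]

theorem kdvPoly_darboux_succ (hu : ContDiff ℝ ∞ u) (hp : p = fun t => u t ^ 2 - deriv u t - l)
    (hq : q = fun t => u t ^ 2 + deriv u t - l) (n : ℕ) (t : ℝ) :
    kdvPoly q (n + 1) t - kdvPoly p (n + 1) t =
      deriv (deriv (kdvPoly p n)) t + 2 * u t * deriv (kdvPoly p n) t
        + 2 * deriv u t * kdvPoly p n t - 2 * l * (kdvPoly q n t - kdvPoly p n t) := by
  rw [kdvPoly_darboux hu hp hq, kdvPoly_darboux hu hp hq, darbouxSeq]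
  ring

/-- `g_{n+1} - f_{n+1} + 2 l (g_n - f_n)` is a total derivative, so that all `∫ (g_n - f_n)` vanish
with the first one. -/
theorem integral_kdvPoly_darboux (hu : ContDiff ℝ ∞ u)
    (pu : ∀ t, u (t + Real.pi) = u t) (hp : p = fun t => u t ^ 2 - deriv u t - l)
    (hq : q = fun t => u t ^ 2 + deriv u t - l) (n : ℕ) :
    ∫ t in (0 : ℝ)..Real.pi, (kdvPoly q n t - kdvPoly p n t) = 0 := by
  have hu1 := contDiff_deriv hu
  have sp : ContDiff ℝ ∞ p := hp ▸ ((hu.pow 2).sub hu1).sub contDiff_const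
  have pp (t : ℝ) : p (t + Real.pi) = p t := by rw [hp]; simp only [pu, deriv_periodic pu]
  have sq : ContDiff ℝ ∞ q := hq ▸ ((hu.pow 2).add hu1).sub contDiff_const
  induction n with
  | zero => simp [kdvPoly_zero]
  | succ n ih =>
    have s0 := kdvPoly_contDiff sp n
    have s1 := contDiff_deriv s0
    have c0 := s0.continuous
    have c1 := s1.continuous
    have c2 := (contDiff_deriv s1).continuous
    have cu := hu.continuous
    have cu1 := hu1.continuous
    have cg := (kdvPoly_contDiff sq n).continuous
    have cM : Continuous fun t => deriv (deriv (kdvPoly p n)) t + 2 * u t * deriv (kdvPoly p n) t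
        + 2 * deriv u t * kdvPoly p n t := by fun_prop
    have cY : Continuous fun t => 2 * l * (kdvPoly q n t - kdvPoly p n t) := by fun_prop
    simp only [kdvPoly_darboux_succ hu hp hq]
    rw [intervalIntegral.integral_sub (cM.intervalIntegrable _ _) (cY.intervalIntegrable _ _),
      intervalIntegral.integral_const_mul, ih, mul_zero, sub_zero]
    refine integral_eq_zero_of_hasDerivAt
      (h := fun t => deriv (kdvPoly p n) t + 2 * u t * kdvPoly p n t) (fun t => ?_) cM
      fun t => ?_
    · refine ((hasDerivAt_of_contDiff s1 t).fun_add (((hasDerivAt_of_contDiff hu t).const_mul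
        2).fun_mul (hasDerivAt_of_contDiff s0 t))).congr_deriv ?_
      ring
    · rw [deriv_periodic (kdvPoly_periodic pp n), kdvPoly_periodic pp n, pu]

end Darboux

/-! ### The map `T_c` and the Riccati equation -/

/-- The slope `u` of an image under `T_c`: `Δ = c u Γ + c Γ'`. -/
def slope (c : ℝ) (Γ Δ : ℝ → ℝ × ℝ) (t : ℝ) : ℝ := det (Δ t) (deriv Γ t) / c

section Image

variable {c : ℝ} {Γ Δ : ℝ → ℝ × ℝ}

theorem slope_contDiff (hΓ : IsCurve Γ) (hΔ : IsCurve Δ) : ContDiff ℝ ∞ (slope c Γ Δ) :=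
  (contDiff_det hΔ.smooth hΓ.smooth_deriv).div_const c

theorem slope_periodic (hΓ : IsCurve Γ) (hΔ : IsCurve Δ) (t : ℝ) :
    slope c Γ Δ (t + Real.pi) = slope c Γ Δ t := by
  rw [slope, deriv_antiperiodic hΓ.antiperiodic, hΔ.antiperiodic, det_neg_neg, slope]

theorem IsImage.eq_slope (h : IsImage c Γ Δ) (hc : c ≠ 0) (t : ℝ) :
    Δ t = (c * slope c Γ Δ t) • Γ t + c • deriv Γ t := by
  rw [slope, mul_div_cancel₀ _ hc]
  have := eq_of_det_eq_one (h.left.det_eq_one t) (Δ t)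
  rwa [h.det_eq] at this

theorem hasDerivAt_slope_curve (hΓ : IsCurve Γ) {u : ℝ → ℝ} {u' t : ℝ} (hu : HasDerivAt u u' t) :
    HasDerivAt (fun t => (c * u t) • Γ t + c • deriv Γ t)
      ((c * (u' + potential Γ t)) • Γ t + (c * u t) • deriv Γ t) t := by
  refine (((hu.const_mul c).fun_smul (hΓ.hasDerivAt t)).fun_add
    ((hΓ.hasDerivAt_deriv t).const_smul c)).congr_deriv ?_
  module

theorem IsImage.deriv_eq (h : IsImage c Γ Δ) (hc : c ≠ 0) (t : ℝ) :
    deriv Δ t = (c * (deriv (slope c Γ Δ) t + potential Γ t)) • Γ t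
      + (c * slope c Γ Δ t) • deriv Γ t := by
  have h1 := hasDerivAt_slope_curve (c := c) h.left
    (hasDerivAt_of_contDiff (slope_contDiff (c := c) h.left h.right) t)
  rw [← funext (h.eq_slope hc)] at h1
  exact h1.deriv

/-- The Riccati equation for the slope. -/
theorem IsImage.riccati (h : IsImage c Γ Δ) (hc : c ≠ 0) (t : ℝ) :
    deriv (slope c Γ Δ) t = slope c Γ Δ t ^ 2 - 1 / c ^ 2 - potential Γ t := by
  have h1 := h.right.det_eq_one t
  rw [h.deriv_eq hc t] at h1
  rw [h.eq_slope hc t, det_combination (h.left.det_eq_one t)] at h1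
  field_simp
  linear_combination -h1

theorem IsImage.potential_left (h : IsImage c Γ Δ) (hc : c ≠ 0) :
    potential Γ = fun t => slope c Γ Δ t ^ 2 - deriv (slope c Γ Δ) t - 1 / c ^ 2 := by
  ext t
  rw [h.riccati hc]
  ring

theorem IsImage.potential_right (h : IsImage c Γ Δ) (hc : c ≠ 0) :
    potential Δ = fun t => slope c Γ Δ t ^ 2 + deriv (slope c Γ Δ) t - 1 / c ^ 2 := by
  have hu := slope_contDiff (c := c) h.left h.right
  have e : deriv Δ = fun t => (c * (slope c Γ Δ t ^ 2 - 1 / c ^ 2)) • Γ t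
      + (c * slope c Γ Δ t) • deriv Γ t := by
    ext1 t
    rw [h.deriv_eq hc, h.riccati hc, sub_add_cancel]
  ext t
  have du := hasDerivAt_of_contDiff hu t
  have e2 := (((((du.fun_pow 2).sub_const (1 / c ^ 2)).const_mul c).fun_smul
    (h.left.hasDerivAt t)).fun_add
      ((du.const_mul c).fun_smul (h.left.hasDerivAt_deriv t))).deriv
  rw [← e] at e2
  have h1 := congrArg (fun v => det (Γ t) v) (deriv_deriv_eq h.right t)
  have h2 : det (Γ t) (potential Δ t • Δ t) = potential Δ t * c := by
    rw [← h.det_eq t]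
    simp only [det, Prod.smul_fst, Prod.smul_snd, smul_eq_mul]
    ring
  have h3 : det (Γ t) (deriv (deriv Δ) t) =
      c * (slope c Γ Δ t ^ 2 - 1 / c ^ 2) + c * deriv (slope c Γ Δ) t := by
    rw [e2]
    have := h.left.det_eq_one t
    simp only [det, Prod.fst_add, Prod.snd_add, Prod.smul_fst, Prod.smul_snd, smul_eq_mul] at *
    linear_combination (c * (slope c Γ Δ t ^ 2 - 1 / c ^ 2) + c * deriv (slope c Γ Δ) t) * this
  simp only [h2, h3] at h1
  refine mul_right_cancel₀ hc ?_
  linear_combination -h1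

/-- The linearization of `[Γ, Δ] = c` on the fields `U_f, U_g`, in terms of the slope. -/
theorem IsImage.det_tangent_add (h : IsImage c Γ Δ) (hc : c ≠ 0) (f g : ℝ → ℝ) (t : ℝ) :
    det (tangent Γ f t) (Δ t) + det (Γ t) (tangent Δ g t) =
      c * (slope c Γ Δ t * (g t - f t) - (1 / 2) * (deriv g t + deriv f t)) := by
  have h1 := h.left.det_eq_one t
  rw [tangent, tangent, h.deriv_eq hc]
  conv_lhs => rw [h.eq_slope hc t]
  simp only [det, Prod.fst_add, Prod.snd_add, Prod.smul_fst, Prod.smul_snd, smul_eq_mul] at *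
  linear_combination c * (slope c Γ Δ t * (g t - f t) - (1 / 2) * (deriv g t + deriv f t)) * h1

theorem IsImage.differentialRelated (h : IsImage c Γ Δ) (hc : c ≠ 0) (j : ℕ) :
    DifferentialRelated Γ Δ (kdvField j Γ) (kdvField j Δ) := by
  refine ⟨h.left.isTangent_kdvField j, h.right.isTangent_kdvField j, fun t => ?_⟩
  rw [kdvField, kdvField, h.det_tangent_add hc, deriv_kdvPoly_darboux
    (slope_contDiff (c := c) h.left h.right) (h.potential_left hc) (h.potential_right hc)]
  ring

theorem IsImage.kdvHamiltonian_eq (h : IsImage c Γ Δ) (hc : c ≠ 0) (j : ℕ) :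
    kdvHamiltonian j Δ = kdvHamiltonian j Γ := by
  have h1 := integral_kdvPoly_darboux (slope_contDiff (c := c) h.left h.right)
    (slope_periodic h.left h.right) (h.potential_left hc) (h.potential_right hc) j
  rw [intervalIntegral.integral_sub ((h.right.kdvPoly_contDiff j).continuous.intervalIntegrable _ _)
    ((h.left.kdvPoly_contDiff j).continuous.intervalIntegrable _ _), sub_eq_zero] at h1
  rw [kdvHamiltonian, kdvHamiltonian, h1]

end Image

/-! ### Linear differential equations with a parameter -/

section LinearODE

variable {E : Type*} [NormedAddCommGroup E] [NormedSpace ℝ E] {S : Set ℝ} {s₀ : ℝ}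

theorem exists_Icc_subset (hS : IsOpen S) (hS' : IsPreconnected S) (h₀ : s₀ ∈ S) {s : ℝ}
    (hs : s ∈ S) : ∃ a b, s₀ ∈ Set.Ioo a b ∧ s ∈ Set.Ioo a b ∧ Set.Icc a b ⊆ S := by
  obtain ⟨ε, hε, h1⟩ := Metric.nhds_basis_closedBall.mem_iff.1 (hS.mem_nhds h₀)
  obtain ⟨δ, hδ, h2⟩ := Metric.nhds_basis_closedBall.mem_iff.1 (hS.mem_nhds hs)
  rw [Real.closedBall_eq_Icc] at h1 h2
  refine ⟨min (s₀ - ε) (s - δ), max (s₀ + ε) (s + δ), ⟨?_, ?_⟩, ⟨?_, ?_⟩, ?_⟩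
  · exact (min_le_left _ _).trans_lt (by linarith)
  · exact lt_max_of_lt_left (by linarith)
  · exact (min_le_right _ _).trans_lt (by linarith)
  · exact lt_max_of_lt_right (by linarith)
  · refine hS'.ordConnected.out ?_ ?_
    · rcases min_choice (s₀ - ε) (s - δ) with h | h <;> rw [h]
      · exact h1 ⟨le_rfl, by linarith⟩
      · exact h2 ⟨le_rfl, by linarith⟩
    · rcases max_choice (s₀ + ε) (s + δ) with h | h <;> rw [h]
      · exact h1 ⟨by linarith, le_rfl⟩
      · exact h2 ⟨by linarith, le_rfl⟩

theorem continuous_slice {F : Type*} [TopologicalSpace F] {φ : ℝ → ℝ → F}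
    (h : ContinuousOn (fun x : ℝ × ℝ => φ x.1 x.2) (S ×ˢ Set.univ)) (t : ℝ) :
    ContinuousOn (fun s => φ s t) S :=
  h.comp (f := fun s => (s, t)) (by fun_prop) fun _ hs => ⟨hs, Set.mem_univ _⟩

theorem continuousOn_primitive_strip (hS : IsOpen S) (hS' : IsPreconnected S) (h₀ : s₀ ∈ S)
    {φ : ℝ → ℝ → E} (h : ContinuousOn (fun x : ℝ × ℝ => φ x.1 x.2) (S ×ˢ Set.univ)) :
    ContinuousOn (fun x : ℝ × ℝ => ∫ r in s₀..x.1, φ r x.2) (S ×ˢ Set.univ) := by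
  rintro ⟨s, t⟩ ⟨hs, -⟩
  obtain ⟨a, b, hs₀, hsab, hab⟩ := exists_Icc_subset hS hS' h₀ hs
  -- extend `φ` continuously from the strip over `[a, b]`
  obtain ⟨π, hπ⟩ : ∃ π : ℝ → ℝ, π = fun r => max a (min r b) := ⟨_, rfl⟩
  have hle : a ≤ b := (hs₀.1.trans hs₀.2).le
  have cπ : Continuous π := by rw [hπ]; fun_prop
  have hmem (r : ℝ) : π r ∈ S := hab (by
    rw [hπ]
    exact ⟨le_max_left _ _, max_le hle (min_le_right _ _)⟩)
  have hid {r : ℝ} (hr : r ∈ Set.Icc a b) : π r = r := by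
    rw [hπ]; simp [hr.1, hr.2]
  have hψ : Continuous (Function.uncurry fun (x : ℝ × ℝ) r => φ (π r) x.2) :=
    h.comp_continuous (f := fun y : (ℝ × ℝ) × ℝ => (π y.2, y.1.2)) (by fun_prop)
      fun y => ⟨hmem _, Set.mem_univ _⟩
  have hc := intervalIntegral.continuous_parametric_intervalIntegral_of_continuous
    (μ := MeasureTheory.volume) (a₀ := s₀) hψ (s := fun x : ℝ × ℝ => x.1) continuous_fst
  refine (hc.continuousAt.congr ?_).continuousWithinAt
  filter_upwards [(isOpen_Ioo.prod isOpen_univ).mem_nhds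
    (show ((s, t) : ℝ × ℝ) ∈ Set.Ioo a b ×ˢ Set.univ from ⟨hsab, Set.mem_univ _⟩)] with x hx
  refine intervalIntegral.integral_congr fun r hr => ?_
  have hr' : r ∈ Set.Icc a b := Set.uIcc_subset_Icc (Set.Ioo_subset_Icc_self hs₀)
    (Set.Ioo_subset_Icc_self hx.1) hr
  simp only [hid hr']

/-- The terms of the Dyson series of the equation `∂x/∂s = A(s, t) x`, `x(s₀, t) = x₀(t)`. -/
def dysonTerm (A : ℝ → ℝ → E →L[ℝ] E) (x₀ : ℝ → E) (s₀ : ℝ) : ℕ → ℝ → ℝ → E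
  | 0 => fun _ t => x₀ t
  | n + 1 => fun s t => ∫ r in s₀..s, A r t (dysonTerm A x₀ s₀ n r t)

theorem dysonTerm_continuousOn (hS : IsOpen S) (hS' : IsPreconnected S) (h₀ : s₀ ∈ S)
    {A : ℝ → ℝ → E →L[ℝ] E} {x₀ : ℝ → E}
    (hA : ContinuousOn (fun x : ℝ × ℝ => A x.1 x.2) (S ×ˢ Set.univ)) (hx₀ : Continuous x₀)
    (n : ℕ) : ContinuousOn (fun x : ℝ × ℝ => dysonTerm A x₀ s₀ n x.1 x.2) (S ×ˢ Set.univ) := by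
  induction n with
  | zero => exact (hx₀.comp continuous_snd).continuousOn
  | succ n ih =>
    exact continuousOn_primitive_strip hS hS' h₀
      (φ := fun r t => A r t (dysonTerm A x₀ s₀ n r t)) (hA.clm_apply ih)

theorem dysonTerm_bound {A : ℝ → ℝ → E →L[ℝ] E} {x₀ : ℝ → E} {K C t : ℝ} {I : Set ℝ}
    (hI : I.OrdConnected) (h₀ : s₀ ∈ I) (hK : ∀ s ∈ I, ‖A s t‖ ≤ K) (hC : ‖x₀ t‖ ≤ C)
    (n : ℕ) {s : ℝ} (hs : s ∈ I) :
    ‖dysonTerm A x₀ s₀ n s t‖ ≤ C * (K * |s - s₀|) ^ n / (n.factorial : ℝ) := by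
  have hK0 : 0 ≤ K := (norm_nonneg _).trans (hK s₀ h₀)
  have hC0 : 0 ≤ C := (norm_nonneg _).trans hC
  induction n generalizing s with
  | zero => simpa [dysonTerm] using hC
  | succ n ih =>
    have hsub : Set.uIoc s₀ s ⊆ I := Set.uIoc_subset_uIcc.trans (hI.uIcc_subset h₀ hs)
    have h1 : ‖dysonTerm A x₀ s₀ (n + 1) s t‖ ≤
        |∫ r in s₀..s, C * K ^ (n + 1) / (n.factorial : ℝ) * |r - s₀| ^ n| := by
      refine intervalIntegral.norm_integral_le_abs_of_norm_le ?_
        (Continuous.intervalIntegrable (by fun_prop) _ _)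
      refine MeasureTheory.ae_restrict_of_forall_mem measurableSet_uIoc fun r hr => ?_
      calc ‖A r t (dysonTerm A x₀ s₀ n r t)‖
          ≤ K * (C * (K * |r - s₀|) ^ n / (n.factorial : ℝ)) :=
            ((A r t).le_opNorm _).trans (mul_le_mul (hK r (hsub hr)) (ih (hsub hr))
              (norm_nonneg _) hK0)
        _ = _ := by rw [mul_pow]; ring
    refine h1.trans_eq ?_
    rw [intervalIntegral.integral_const_mul, abs_mul, intervalIntegral.abs_intervalIntegral_eq,
      integral_pow_abs_sub_uIoc, abs_of_nonneg (by positivity), abs_of_nonneg (by positivity),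
      Nat.factorial_succ, mul_pow]
    push_cast
    field_simp

/-- Linear equations on an open interval have global solutions, continuous in the parameter. -/
theorem exists_linear_solution [CompleteSpace E] (hS : IsOpen S) (hS' : IsPreconnected S)
    (h₀ : s₀ ∈ S) {A : ℝ → ℝ → E →L[ℝ] E}
    (hA : ContinuousOn (fun x : ℝ × ℝ => A x.1 x.2) (S ×ˢ Set.univ)) {x₀ : ℝ → E}
    (hx₀ : Continuous x₀) :
    ∃ x : ℝ → ℝ → E, (∀ t, x s₀ t = x₀ t) ∧
      ContinuousOn (fun y : ℝ × ℝ => x y.1 y.2) (S ×ˢ Set.univ) ∧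
      ∀ s ∈ S, ∀ t, HasDerivAt (fun r => x r t) (A s t (x s t)) s := by
  have hcont := dysonTerm_continuousOn hS hS' h₀ hA hx₀
  have hbox (s : ℝ) (hs : s ∈ S) (t : ℝ) : ∃ a b K C : ℝ, s₀ ∈ Set.Ioo a b ∧ s ∈ Set.Ioo a b ∧
      Set.Icc a b ⊆ S ∧ (∀ r ∈ Set.Icc a b, ∀ τ ∈ Set.Icc (t - 1) (t + 1), ‖A r τ‖ ≤ K) ∧
      ∀ n, ∀ r ∈ Set.Icc a b, ∀ τ ∈ Set.Icc (t - 1) (t + 1),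
        ‖dysonTerm A x₀ s₀ n r τ‖ ≤ C * ((K * (b - a)) ^ n / (n.factorial : ℝ)) := by
    obtain ⟨a, b, h1, h2, h3⟩ := exists_Icc_subset hS hS' h₀ hs
    obtain ⟨K, hK⟩ := (isCompact_Icc.prod isCompact_Icc).exists_bound_of_continuousOn
      (hA.mono (Set.prod_mono h3 (Set.subset_univ (Set.Icc (t - 1) (t + 1)))))
    obtain ⟨C, hC⟩ := (isCompact_Icc (a := t - 1) (b := t + 1)).exists_bound_of_continuousOn
      hx₀.continuousOn
    have h0 : s₀ ∈ Set.Icc a b := Set.Ioo_subset_Icc_self h1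
    refine ⟨a, b, K, C, h1, h2, h3, fun r hr τ hτ => hK (r, τ) ⟨hr, hτ⟩, fun n r hr τ hτ => ?_⟩
    refine (dysonTerm_bound Set.ordConnected_Icc h0 (fun s hs => hK (s, τ) ⟨hs, hτ⟩) (hC τ hτ)
      n hr).trans ?_
    have hK0 : 0 ≤ K := (norm_nonneg _).trans (hK (r, τ) ⟨hr, hτ⟩)
    have hC0 : 0 ≤ C := (norm_nonneg _).trans (hC τ hτ)
    have habs : |r - s₀| ≤ b - a := abs_sub_le_iff.2 ⟨by linarith [hr.2, h0.1],
      by linarith [h0.2, hr.1]⟩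
    rw [mul_div_assoc]
    gcongr
  have hmem (t : ℝ) : t ∈ Set.Icc (t - 1) (t + 1) := ⟨by linarith, by linarith⟩
  refine ⟨fun s t => ∑' n, dysonTerm A x₀ s₀ n s t, fun t => ?_, ?_, fun s hs t => ?_⟩
  · dsimp only
    rw [tsum_eq_single 0]
    · rfl
    · intro n hn
      obtain ⟨m, rfl⟩ := Nat.exists_eq_succ_of_ne_zero hn
      exact intervalIntegral.integral_same
  · rintro ⟨s, t⟩ ⟨hs, -⟩
    obtain ⟨a, b, K, C, h1, h2, h3, hK, hC⟩ := hbox s hs t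
    have hc := continuousOn_tsum (fun n => (hcont n).mono
      (Set.prod_mono h3 (Set.subset_univ (Set.Icc (t - 1) (t + 1)))))
      ((Real.summable_pow_div_factorial (K * (b - a))).mul_left C)
      fun n x hx => hC n x.1 hx.1 x.2 hx.2
    exact (hc.continuousAt (prod_mem_nhds (Icc_mem_nhds h2.1 h2.2)
      (Icc_mem_nhds (by linarith) (by linarith)))).continuousWithinAt
  · obtain ⟨a, b, K, C, h1, h2, h3, hK, hC⟩ := hbox s hs t
    have h3' : Set.Ioo a b ⊆ S := Set.Ioo_subset_Icc_self.trans h3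
    have hsum (r : ℝ) (hr : r ∈ Set.Icc a b) : Summable fun n => dysonTerm A x₀ s₀ n r t :=
      Summable.of_norm_bounded ((Real.summable_pow_div_factorial (K * (b - a))).mul_left C)
        fun n => hC n r hr t (hmem t)
    have hAc (n : ℕ) : ContinuousOn (fun r => A r t (dysonTerm A x₀ s₀ n r t)) S :=
      continuous_slice (φ := fun r t => A r t (dysonTerm A x₀ s₀ n r t)) (hA.clm_apply (hcont n)) t
    have hbd : Summable fun n : ℕ => Nat.casesOn (motive := fun _ => ℝ) n 0
        fun n => K * (C * ((K * (b - a)) ^ n / (n.factorial : ℝ))) :=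
      (summable_nat_add_iff 1).1
        (((Real.summable_pow_div_factorial (K * (b - a))).mul_left C).mul_left K)
    have hd := hasDerivAt_tsum_of_isPreconnected (t := Set.Ioo a b)
      (g := fun n r => dysonTerm A x₀ s₀ n r t)
      (g' := fun n r => Nat.casesOn (motive := fun _ => E) n 0
        fun n => A r t (dysonTerm A x₀ s₀ n r t)) hbd isOpen_Ioo isPreconnected_Ioo
      (fun n r hr => by
        cases n with
        | zero => exact hasDerivAt_const r (x₀ t)
        | succ n =>
          refine intervalIntegral.integral_hasDerivAt_right ?_ ?_
            ((hAc n).continuousAt (hS.mem_nhds (h3' hr)))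
          · refine ((hAc n).mono ?_).intervalIntegrable
            exact hS'.ordConnected.uIcc_subset h₀ (h3' hr)
          · exact (hAc n).stronglyMeasurableAtFilter hS _ (h3' hr))
      (fun n r hr => by
        have hr' := Set.Ioo_subset_Icc_self hr
        cases n with
        | zero => simp
        | succ n =>
          exact ((A r t).le_opNorm _).trans (mul_le_mul (hK r hr' t (hmem t))
            (hC n r hr' t (hmem t)) (norm_nonneg _) ((norm_nonneg _).trans (hK r hr' t (hmem t)))))
      h1 (hsum s₀ (Set.Ioo_subset_Icc_self h1)) h2
    refine hd.congr_deriv ?_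
    have hs' := hsum s (Set.Ioo_subset_Icc_self h2)
    rw [(A s t).map_tsum hs', Summable.tsum_eq_zero_add]
    · simp
    · exact (summable_nat_add_iff 1).1 ((A s t).summable hs')

theorem gronwallBound_eq (δ K ε x : ℝ) :
    gronwallBound δ K ε x = δ * gronwallBound 1 K 0 x + ε * gronwallBound 0 K 1 x := by
  unfold gronwallBound
  split_ifs <;> ring

/-- Grönwall's inequality on an interval with arbitrary orientation. -/
theorem norm_le_gronwallBound_uIcc {y y' : ℝ → E} {s₁ K ε : ℝ}
    (hy : ∀ s ∈ Set.uIcc s₀ s₁, HasDerivAt y (y' s) s)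
    (hb : ∀ s ∈ Set.uIcc s₀ s₁, ‖y' s‖ ≤ K * ‖y s‖ + ε) :
    ‖y s₁‖ ≤ gronwallBound ‖y s₀‖ (|s₁ - s₀| * K) (|s₁ - s₀| * ε) 1 := by
  have hmem {r : ℝ} (hr : r ∈ Set.Icc (0 : ℝ) 1) : s₀ + r * (s₁ - s₀) ∈ Set.uIcc s₀ s₁ := by
    rw [← segment_eq_uIcc, segment_eq_image']
    exact ⟨r, hr, by simp⟩
  have hd (r : ℝ) (hr : r ∈ Set.Icc (0 : ℝ) 1) : HasDerivAt (fun r => y (s₀ + r * (s₁ - s₀)))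
      ((s₁ - s₀) • y' (s₀ + r * (s₁ - s₀))) r := by
    have h1 : HasDerivAt (fun r : ℝ => s₀ + r * (s₁ - s₀)) (s₁ - s₀) r := by
      simpa using ((hasDerivAt_id r).mul_const (s₁ - s₀)).const_add s₀
    exact (hy _ (hmem hr)).scomp r h1
  have := norm_le_gronwallBound_of_norm_deriv_right_le (a := 0) (b := 1)
    (δ := ‖y s₀‖) (K := |s₁ - s₀| * K) (ε := |s₁ - s₀| * ε)
    (fun r hr => (hd r hr).continuousAt.continuousWithinAt)
    (fun r hr => (hd r (Set.Ico_subset_Icc_self hr)).hasDerivWithinAt) (by simp)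
    (fun r hr => by
      rw [norm_smul, Real.norm_eq_abs, mul_assoc, ← mul_add]
      exact mul_le_mul_of_nonneg_left (hb _ (hmem (Set.Ico_subset_Icc_self hr))) (abs_nonneg _))
    1 ⟨zero_le_one, le_rfl⟩
  simpa using this

theorem linear_solution_eq_zero (hS' : IsPreconnected S) (h₀ : s₀ ∈ S)
    {A : ℝ → E →L[ℝ] E} (hA : ContinuousOn A S) {y : ℝ → E}
    (hy : ∀ s ∈ S, HasDerivAt y (A s (y s)) s) (h : y s₀ = 0) {s : ℝ} (hs : s ∈ S) : y s = 0 := by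
  have hsub := hS'.ordConnected.uIcc_subset h₀ hs
  obtain ⟨K, hK⟩ := isCompact_uIcc.exists_bound_of_continuousOn (hA.mono hsub)
  have := norm_le_gronwallBound_uIcc (K := K) (ε := 0) (fun r hr => hy r (hsub hr))
    fun r hr => by
      rw [add_zero]
      exact (A r).le_of_opNorm_le (hK r hr) _
  rw [h, norm_zero, mul_zero, gronwallBound_ε0_δ0] at this
  exact norm_le_zero_iff.1 this

/-- If `L, M` satisfy the zero curvature equation `L_s + L M = M_t + M L`, a solution of
`∂x/∂s = M x` that satisfies `∂x/∂t = L x` for `s = s₀` satisfies it for all `s`: the defect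
`x(s, t + h) - x(s, t) - h L x(s, t)` satisfies the equation in `s` up to `O(h²)`. -/
theorem hasDerivAt_of_zero_curvature (hS : IsOpen S) (hS' : IsPreconnected S) (h₀ : s₀ ∈ S)
    {L M : ℝ → ℝ → E →L[ℝ] E} (hL : SmoothOn S L) (hM : SmoothOn S M)
    (hzc : ∀ s ∈ S, ∀ t, deriv (fun r => L r t) s + (L s t).comp (M s t) =
      deriv (M s) t + (M s t).comp (L s t))
    {x : ℝ → ℝ → E} (hx : ∀ s ∈ S, ∀ t, HasDerivAt (fun r => x r t) (M s t (x s t)) s)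
    (hx₀ : ∀ t, HasDerivAt (x s₀) (L s₀ t (x s₀ t)) t) {s : ℝ} (hs : s ∈ S) (t : ℝ) :
    HasDerivAt (x s) (L s t (x s t)) t := by
  have hsub := hS'.ordConnected.uIcc_subset h₀ hs
  have hM1 := hM.deriv_right hS
  have hM2 := hM1.deriv_right hS
  have hbox : IsCompact (Set.uIcc s₀ s ×ˢ Set.Icc (t - 1) (t + 1)) :=
    isCompact_uIcc.prod isCompact_Icc
  have hboxsub : Set.uIcc s₀ s ×ˢ Set.Icc (t - 1) (t + 1) ⊆ S ×ˢ Set.univ :=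
    Set.prod_mono hsub (Set.subset_univ _)
  have hmem : t ∈ Set.Icc (t - 1) (t + 1) := ⟨by linarith, by linarith⟩
  obtain ⟨K, hK⟩ := hbox.exists_bound_of_continuousOn ((ContDiffOn.continuousOn hM).mono hboxsub)
  obtain ⟨K1, hK1⟩ := hbox.exists_bound_of_continuousOn
    ((ContDiffOn.continuousOn hM1).mono hboxsub)
  obtain ⟨K2, hK2⟩ := hbox.exists_bound_of_continuousOn
    ((ContDiffOn.continuousOn hM2).mono hboxsub)
  have cx : ContinuousOn (fun r => x r t) (Set.uIcc s₀ s) := fun r hr =>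
    (hx r (hsub hr) t).continuousAt.continuousWithinAt
  have cL : ContinuousOn (fun r => L r t) (Set.uIcc s₀ s) :=
    (continuous_slice (ContDiffOn.continuousOn hL) t).mono hsub
  obtain ⟨C, hC⟩ := isCompact_uIcc.exists_bound_of_continuousOn cx
  obtain ⟨C', hC'⟩ := isCompact_uIcc.exists_bound_of_continuousOn (cL.clm_apply cx)
  -- Taylor estimates for `M` in the variable `t`
  have lip {f f' : ℝ → E →L[ℝ] E} {B h : ℝ} (hf : ∀ τ, HasDerivAt f (f' τ) τ)
      (hB : ∀ τ ∈ Set.uIcc t (t + h), ‖f' τ‖ ≤ B) : ‖f (t + h) - f t‖ ≤ B * |h| := by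
    have := (convex_uIcc t (t + h)).norm_image_sub_le_of_norm_hasDerivWithin_le
      (fun τ _ => (hf τ).hasDerivWithinAt) hB Set.left_mem_uIcc Set.right_mem_uIcc
    rwa [add_sub_cancel_left, Real.norm_eq_abs] at this
  have hseg {h : ℝ} (hh : |h| ≤ 1) : Set.uIcc t (t + h) ⊆ Set.Icc (t - 1) (t + 1) := by
    have := abs_le.1 hh
    exact Set.uIcc_subset_Icc hmem ⟨by linarith, by linarith⟩
  have lip0 {r h : ℝ} (hr : r ∈ Set.uIcc s₀ s) (hh : |h| ≤ 1) :
      ‖M r (t + h) - M r t‖ ≤ K1 * |h| :=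
    lip (fun τ => hM.hasDerivAt_right hS (hsub hr) τ) fun τ hτ => hK1 (r, τ) ⟨hr, hseg hh hτ⟩
  have lip1 {r h : ℝ} (hr : r ∈ Set.uIcc s₀ s) (hh : |h| ≤ 1) :
      ‖M r (t + h) - M r t - h • deriv (M r) t‖ ≤ K2 * |h| * |h| := by
    have hd1 (τ : ℝ) : HasDerivAt (fun τ => M r τ - τ • deriv (M r) t)
        (deriv (M r) τ - deriv (M r) t) τ := by
      simpa using (hM.hasDerivAt_right hS (hsub hr) τ).fun_sub
        ((hasDerivAt_id τ).smul_const (deriv (M r) t))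
    have := lip (h := h) (B := K2 * |h|) hd1 fun τ hτ => by
      obtain ⟨k, rfl⟩ : ∃ k, τ = t + k := ⟨τ - t, by ring⟩
      have hk : |k| ≤ |h| := by simpa using Set.abs_sub_left_of_mem_uIcc hτ
      have hk1 : |k| ≤ 1 := hk.trans hh
      have h2 : ‖deriv (M r) (t + k) - deriv (M r) t‖ ≤ K2 * |k| :=
        lip (fun τ => hM1.hasDerivAt_right hS (hsub hr) τ)
          fun τ hτ => hK2 (r, τ) ⟨hr, hseg hk1 hτ⟩
      have hK20 : 0 ≤ K2 := (norm_nonneg _).trans (hK2 (r, t) ⟨hr, hmem⟩)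
      exact h2.trans (mul_le_mul_of_nonneg_left hk hK20)
    convert this using 2
    rw [add_smul]
    abel
  -- the defect
  have hdef (h : ℝ) (hh : |h| ≤ 1) :
      ‖x s (t + h) - x s t - h • L s t (x s t)‖ ≤
        ‖x s₀ (t + h) - x s₀ t - h • L s₀ t (x s₀ t)‖ * gronwallBound 1 (|s - s₀| * K) 0 1
          + |s - s₀| * ((K2 * C + K1 * C') * (|h| * |h|))
            * gronwallBound 0 (|s - s₀| * K) 1 1 := by
    rw [← gronwallBound_eq]
    have hth : t + h ∈ Set.Icc (t - 1) (t + 1) := hseg hh Set.right_mem_uIcc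
    refine norm_le_gronwallBound_uIcc (y := fun r => x r (t + h) - x r t - h • L r t (x r t))
      (y' := fun r => M r (t + h) (x r (t + h) - x r t - h • L r t (x r t))
        + (M r (t + h) - M r t - h • deriv (M r) t) (x r t)
        + h • (M r (t + h) - M r t) (L r t (x r t))) (fun r hr => ?_) fun r hr => ?_
    · have h1 := ((hx r (hsub hr) (t + h)).fun_sub (hx r (hsub hr) t)).fun_sub
        (((hL.hasDerivAt_left hS (hsub hr) t).clm_apply (hx r (hsub hr) t)).const_smul h)
      refine h1.congr_deriv ?_
      have h2 := congrArg (fun T : E →L[ℝ] E => T (x r t)) (hzc r (hsub hr) t)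
      simp only [add_apply, ContinuousLinearMap.comp_apply] at h2
      rw [h2]
      simp only [sub_apply, smul_apply, map_sub, map_smul]
      module
    · have n1 := (M r (t + h)).le_of_opNorm_le (hK (r, t + h) ⟨hr, hth⟩)
        (x r (t + h) - x r t - h • L r t (x r t))
      have n2 := (M r (t + h) - M r t - h • deriv (M r) t).le_of_opNorm_le_of_le
        (lip1 hr hh) (hC r hr)
      have n3 := (M r (t + h) - M r t).le_of_opNorm_le_of_le (lip0 hr hh) (hC' r hr)
      refine (norm_add₃_le).trans ?_
      rw [norm_smul, Real.norm_eq_abs]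
      nlinarith [mul_le_mul_of_nonneg_left n3 (abs_nonneg h)]
  rw [hasDerivAt_iff_isLittleO_nhds_zero]
  have hx0 := (hasDerivAt_iff_isLittleO_nhds_zero.1 (hx₀ t)).norm_left
  have hquad : (fun h : ℝ => |h| * |h|) =o[nhds 0] fun h : ℝ => h := by
    have h1 : (fun h : ℝ => |h|) =o[nhds 0] fun _ : ℝ => (1 : ℝ) := by
      rw [Asymptotics.isLittleO_one_iff]
      simpa using (continuous_abs : Continuous fun h : ℝ => |h|).tendsto 0
    simpa using h1.mul_isBigO (Asymptotics.isBigO_refl (fun h : ℝ => h) (nhds 0)).abs_left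
  have hsum := (hx0.const_mul_left (gronwallBound 1 (|s - s₀| * K) 0 1)).add
    (hquad.const_mul_left (|s - s₀| * (K2 * C + K1 * C') * gronwallBound 0 (|s - s₀| * K) 1 1))
  refine (Asymptotics.IsBigO.of_bound 1 ?_).trans_isLittleO hsum
  filter_upwards [Metric.closedBall_mem_nhds (0 : ℝ) one_pos] with h hh
  rw [one_mul]
  refine (hdef h (by simpa using hh)).trans (le_trans (le_of_eq ?_) (le_abs_self _))
  ring

/-- A continuous solution of a smooth linear system in two variables is smooth. -/
theorem smoothOn_of_linear_system (hS : IsOpen S) {L M : ℝ → ℝ → E →L[ℝ] E} (hL : SmoothOn S L)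
    (hM : SmoothOn S M) {x : ℝ → ℝ → E}
    (hc : ContinuousOn (fun y : ℝ × ℝ => x y.1 y.2) (S ×ˢ Set.univ))
    (hxs : ∀ s ∈ S, ∀ t, HasDerivAt (fun r => x r t) (M s t (x s t)) s)
    (hxt : ∀ s ∈ S, ∀ t, HasDerivAt (x s) (L s t (x s t)) t) : SmoothOn S x := by
  have hO := isOpen_strip hS
  have hf (y : ℝ × ℝ) (hy : y ∈ S ×ˢ (Set.univ : Set ℝ)) :
      HasFDerivAt (fun y : ℝ × ℝ => x y.1 y.2)
        ((ContinuousLinearMap.fst ℝ ℝ ℝ).smulRight (M y.1 y.2 (x y.1 y.2))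
          + (ContinuousLinearMap.snd ℝ ℝ ℝ).smulRight (L y.1 y.2 (x y.1 y.2))) y := by
    have hev := hO.mem_nhds hy
    have hcM := (((ContDiffOn.continuousOn hM).clm_apply hc).continuousAt hev)
    have hcL := (((ContDiffOn.continuousOn hL).clm_apply hc).continuousAt hev)
    have h1 := hasStrictFDerivAt_uncurry_coprod (𝕜 := ℝ) (u := y) (f := x)
      (f₁ := fun s t => (1 : ℝ →L[ℝ] ℝ).smulRight (M s t (x s t)))
      (f₂ := fun s t => (1 : ℝ →L[ℝ] ℝ).smulRight (L s t (x s t)))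
      (Filter.mem_of_superset hev fun v hv => (hxs v.1 hv.1 v.2).hasFDerivAt)
      (Filter.mem_of_superset hev fun v hv => (hxt v.1 hv.1 v.2).hasFDerivAt)
      ((ContinuousLinearMap.smulRightL ℝ ℝ E 1).continuous.continuousAt.comp hcM)
      ((ContinuousLinearMap.smulRightL ℝ ℝ E 1).continuous.continuousAt.comp hcL)
    refine h1.hasFDerivAt.congr_fderiv ?_
    ext <;> simp [Function.HasUncurry.uncurry]
  have hn (n : ℕ) : ContDiffOn ℝ n (fun y : ℝ × ℝ => x y.1 y.2) (S ×ˢ Set.univ) := by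
    induction n with
    | zero => exact contDiffOn_zero.2 hc
    | succ n ih =>
      have hle : ((n : ℕ∞) : WithTop ℕ∞) ≤ ∞ := WithTop.coe_le_coe.2 le_top
      push_cast
      rw [contDiffOn_succ_iff_fderiv_of_isOpen hO]
      refine ⟨fun y hy => (hf y hy).differentiableAt.differentiableWithinAt, by simp, ?_⟩
      refine ContDiffOn.congr ?_ fun y hy => (hf y hy).fderiv
      exact (contDiffOn_const.smulRight ((ContDiffOn.of_le hM hle).clm_apply ih)).add
        (contDiffOn_const.smulRight ((ContDiffOn.of_le hL hle).clm_apply ih))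
  exact contDiffOn_infty.2 hn

end LinearODE

/-! ### Curves paired to a constant with a simple curve are simple -/

/-- Two zeros of a function cannot be such that the derivative is positive at all zeros between
them, themselves included. -/
theorem not_exists_zeros_of_deriv_pos {f f' : ℝ → ℝ} (hf : ∀ t, HasDerivAt f (f' t) t) {a b : ℝ}
    (hab : a < b) (ha : f a = 0) (hb : f b = 0)
    (hpos : ∀ t ∈ Set.Icc a b, f t = 0 → 0 < f' t) : False := by
  have hc : Continuous f := continuous_iff_continuousAt.2 fun t => (hf t).continuousAt
  have hsign (t : ℝ) (ht : t ∈ Set.Icc a b) (h0 : f t = 0) :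
      ∀ᶠ x in nhds t, SignType.sign (f x) = SignType.sign (x - t) :=
    eventually_nhdsWithin_sign_eq_of_deriv_pos (by rw [(hf t).deriv]; exact hpos t ht h0) h0
  obtain ⟨a', ⟨ha1, ha2⟩, ha3⟩ : ∃ a' ∈ Set.Ioo a b, 0 < f a' := by
    have h1 : ∀ᶠ x in nhdsWithin a (Set.Ioi a), x ∈ Set.Ioo a b := Ioo_mem_nhdsGT hab
    have h2 := (hsign a ⟨le_rfl, hab.le⟩ ha).filter_mono (nhdsWithin_le_nhds (s := Set.Ioi a))
    obtain ⟨x, hx1, hx2⟩ := (h1.and h2).exists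
    refine ⟨x, hx1, sign_eq_one_iff.1 ?_⟩
    rw [hx2, sign_eq_one_iff]
    linarith [hx1.1]
  -- the first zero after `a'`
  have hK : IsCompact (Set.Icc a' b ∩ f ⁻¹' {0}) :=
    isCompact_Icc.inter_right (isClosed_singleton.preimage hc)
  obtain ⟨c, ⟨⟨hc1, hc2⟩, hc3⟩, hleast⟩ := hK.exists_isLeast ⟨b, ⟨ha2.le, le_rfl⟩, hb⟩
  have hc3 : f c = 0 := hc3
  have hac : a' < c := lt_of_le_of_ne hc1 fun h => by rw [h, hc3] at ha3; exact lt_irrefl _ ha3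
  have h1 : ∀ᶠ x in nhdsWithin c (Set.Iio c), x ∈ Set.Ioo a' c := Ioo_mem_nhdsLT hac
  have h2 := (hsign c ⟨(ha1.trans hac).le, hc2⟩ hc3).filter_mono
    (nhdsWithin_le_nhds (s := Set.Iio c))
  obtain ⟨x, hx1, hx2⟩ := (h1.and h2).exists
  have hx3 : f x < 0 := by
    rw [← sign_eq_neg_one_iff, hx2, sign_eq_neg_one_iff]
    linarith [hx1.2]
  obtain ⟨y, hy1, hy2⟩ := intermediate_value_Icc' hx1.1.le hc.continuousOn ⟨hx3.le, ha3.le⟩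
  exact absurd (hleast ⟨⟨hy1.1, hy1.2.trans (hx1.2.le.trans hc2)⟩, hy2⟩)
    (by linarith [hy1.2, hx1.2])

theorem IsCurve.simple_Ico {Γ : ℝ → ℝ × ℝ} (h : IsCurve Γ) {s x y : ℝ}
    (hs : s ∈ Set.Ico 0 Real.pi) (hx : x ∈ Set.Ico s (s + Real.pi))
    (hy : y ∈ Set.Ico s (s + Real.pi)) (hdet : det (Γ x) (Γ y) = 0) : x = y := by
  have hsub (z : ℝ) : Γ z = -Γ (z - Real.pi) := by
    rw [← h.antiperiodic, sub_add_cancel]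
  have neg_left (v w : ℝ × ℝ) : det (-v) w = -det v w := by simp [det]; ring
  have neg_right (v w : ℝ × ℝ) : det v (-w) = -det v w := by simp [det]; ring
  obtain ⟨hs0, hs1⟩ := hs
  obtain ⟨hx0, hx1⟩ := hx
  obtain ⟨hy0, hy1⟩ := hy
  rcases lt_or_ge x Real.pi with hx | hx <;> rcases lt_or_ge y Real.pi with hy | hy
  · exact h.simple x ⟨by linarith, hx⟩ y ⟨by linarith, hy⟩ hdet
  · rw [hsub y, neg_right, neg_eq_zero] at hdet
    linarith [h.simple x ⟨by linarith, hx⟩ _ ⟨by linarith, by linarith⟩ hdet]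
  · rw [hsub x, neg_left, neg_eq_zero] at hdet
    linarith [h.simple _ ⟨by linarith, by linarith⟩ y ⟨by linarith, hy⟩ hdet]
  · rw [hsub x, hsub y, det_neg_neg] at hdet
    linarith [h.simple _ ⟨by linarith, by linarith⟩ _ ⟨by linarith, by linarith⟩ hdet]

/-- If `[Γ, Δ] = c ≠ 0` with `Γ` making half a rotation on a period, so does `Δ`. With
`v = Δ(s)`, the derivative of `[v, Δ]` at its zeros is `[Γ, v] / c`, which changes sign only once
on a period; so `[v, Δ]` has no zeros on `(s, s + π)`. -/
theorem isCurve_of_det_eq {c : ℝ} (hc : c ≠ 0) {Γ Δ : ℝ → ℝ × ℝ} (hΓ : IsCurve Γ)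
    (hΔ : ContDiff ℝ ∞ Δ) (h1 : ∀ t, det (Δ t) (deriv Δ t) = 1)
    (hanti : ∀ t, Δ (t + Real.pi) = -Δ t) (hdet : ∀ t, det (Γ t) (Δ t) = c) : IsCurve Δ := by
  refine ⟨hΔ, h1, hanti, ?_⟩
  have hpi := Real.pi_pos
  suffices key : ∀ s ∈ Set.Ico 0 Real.pi, ∀ t ∈ Set.Ico 0 Real.pi, s < t →
      det (Δ s) (Δ t) ≠ 0 by
    intro s hs t ht h
    rcases lt_trichotomy s t with hst | hst | hst
    · exact absurd h (key s hs t ht hst)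
    · exact hst
    · refine absurd ?_ (key t ht s hs hst)
      simp only [det] at h ⊢
      linarith
  intro s hs t ht hst h0
  obtain ⟨v, hv⟩ : ∃ v, v = Δ s := ⟨_, rfl⟩
  obtain ⟨φ, hφ⟩ : ∃ φ : ℝ → ℝ, φ = fun τ => det (Γ τ) v / c := ⟨_, rfl⟩
  have cφ : Continuous φ := by
    rw [hφ]
    exact ((contDiff_det hΓ.smooth contDiff_const).div_const c).continuous
  have dχ (τ : ℝ) : HasDerivAt (fun τ => det v (Δ τ)) (det v (deriv Δ τ)) τ := by
    refine (det_hasDerivAt (hasDerivAt_const τ v) (hasDerivAt_of_contDiff hΔ τ)).congr_deriv ?_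
    simp [det]
  have hzero (τ : ℝ) (hτ : det v (Δ τ) = 0) : det v (deriv Δ τ) = φ τ := by
    have e := eq_of_det_eq_one (h1 τ) v
    have e0 : det (Δ τ) v = 0 := by simp only [det] at hτ ⊢; linarith
    rw [e0, zero_smul, add_zero] at e
    have e1 : det (Γ τ) v = det v (deriv Δ τ) * c := by
      conv_lhs => rw [e]
      rw [← hdet τ]
      simp only [det, Prod.smul_fst, Prod.smul_snd, smul_eq_mul]
      ring
    rw [hφ]
    simp only [e1, mul_div_cancel_right₀ _ hc]
  have hvne : v ≠ 0 := fun h => by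
    have := h1 s
    rw [← hv, h] at this
    simp [det] at this
  have φs : φ s = 1 := by simp only [hφ, hv, hdet, div_self hc]
  have φs' : φ (s + Real.pi) = -1 := by
    rw [← φs, hφ]
    simp only [hΓ.antiperiodic, det, Prod.fst_neg, Prod.snd_neg]
    ring
  have huniq {x y : ℝ} (hx : x ∈ Set.Ico s (s + Real.pi)) (hy : y ∈ Set.Ico s (s + Real.pi))
      (hx0 : φ x = 0) (hy0 : φ y = 0) : x = y := by
    refine hΓ.simple_Ico hs hx hy ?_
    have hx0 : det (Γ x) v = 0 := by simpa [hφ, hc] using hx0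
    have hy0 : det (Γ y) v = 0 := by simpa [hφ, hc] using hy0
    by_contra hne
    refine hvne ?_
    simp only [det] at hx0 hy0 hne
    ext
    · refine (mul_eq_zero.1 ?_).resolve_left hne
      linear_combination (Γ y).1 * hx0 - (Γ x).1 * hy0
    · refine (mul_eq_zero.1 ?_).resolve_left hne
      linear_combination (Γ y).2 * hx0 - (Γ x).2 * hy0
  obtain ⟨z, hz, hz0⟩ : ∃ z ∈ Set.Icc s (s + Real.pi), φ z = 0 :=
    intermediate_value_Icc' (by linarith) cφ.continuousOn ⟨by linarith, by linarith⟩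
  have hz1 : z < s + Real.pi := lt_of_le_of_ne hz.2 fun h => by
    rw [h, φs'] at hz0
    norm_num at hz0
  have hzI : z ∈ Set.Ico s (s + Real.pi) := ⟨hz.1, hz1⟩
  have hχt : det v (Δ t) = 0 := hv ▸ h0
  rcases lt_trichotomy t z with htz | htz | htz
  · refine not_exists_zeros_of_deriv_pos dχ hst (by rw [hv]; simp [det]; ring) hχt
      fun τ hτ h => ?_
    rw [hzero τ h]
    by_contra hneg
    obtain ⟨y, hy, hy0⟩ : ∃ y ∈ Set.Icc s τ, φ y = 0 :=
      intermediate_value_Icc' hτ.1 cφ.continuousOn ⟨by linarith, by linarith⟩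
    have := huniq (x := y) ⟨hy.1, by linarith [hy.2, hτ.2]⟩ hzI hy0 hz0
    linarith [hy.2, hτ.2]
  · have e := eq_of_det_eq_one (h1 t) v
    have e0 : det (Δ t) v = 0 := by simp only [det] at hχt ⊢; linarith
    rw [e0, hzero t hχt, htz, hz0] at e
    exact hvne (e.trans (by simp))
  · have dχ' (τ : ℝ) := (dχ τ).fun_neg
    refine not_exists_zeros_of_deriv_pos dχ' (show t < s + Real.pi by linarith [ht.2, hs.1])
      (by rw [hχt, neg_zero]) ?_ fun τ hτ h => ?_
    · rw [hanti, hv]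
      simp [det]
      ring
    · rw [hzero τ (neg_eq_zero.1 h)]
      by_contra hneg
      obtain ⟨y, hy, hy0⟩ : ∃ y ∈ Set.Icc τ (s + Real.pi), φ y = 0 :=
        intermediate_value_Icc' hτ.2 cφ.continuousOn ⟨by linarith, by linarith⟩
      have hy1 : y < s + Real.pi := lt_of_le_of_ne hy.2 fun h => by
        rw [h, φs'] at hy0
        norm_num at hy0
      have := huniq (x := y) ⟨by linarith [hy.1, hτ.1], hy1⟩ hzI hy0 hz0
      linarith [hy.1, hτ.1]

/-- Periodic solutions of the Riccati equation give images under `T_c`. -/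
theorem isImage_of_riccati {c : ℝ} (hc : c ≠ 0) {Γ : ℝ → ℝ × ℝ} (hΓ : IsCurve Γ) {u : ℝ → ℝ}
    (hu : ContDiff ℝ ∞ u) (pu : ∀ t, u (t + Real.pi) = u t)
    (hric : ∀ t, deriv u t = u t ^ 2 - 1 / c ^ 2 - potential Γ t) :
    IsImage c Γ (fun t => (c * u t) • Γ t + c • deriv Γ t) ∧
      slope c Γ (fun t => (c * u t) • Γ t + c • deriv Γ t) = u := by
  have hdet (t : ℝ) : det (Γ t) ((c * u t) • Γ t + c • deriv Γ t) = c := by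
    have := hΓ.det_eq_one t
    simp only [det, Prod.fst_add, Prod.snd_add, Prod.smul_fst, Prod.smul_snd, smul_eq_mul] at *
    linear_combination c * this
  refine ⟨⟨hΓ, isCurve_of_det_eq hc hΓ ?_ (fun t => ?_) (fun t => ?_) hdet, hdet⟩, ?_⟩
  · exact ((contDiff_const.mul hu).smul hΓ.smooth).add (hΓ.smooth_deriv.const_smul c)
  · rw [(hasDerivAt_slope_curve hΓ (hasDerivAt_of_contDiff hu t)).deriv,
      det_combination (hΓ.det_eq_one t), hric]
    field_simp
    ring
  · rw [pu, hΓ.antiperiodic, deriv_antiperiodic hΓ.antiperiodic]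
    module
  · ext t
    have := hΓ.det_eq_one t
    rw [slope, div_eq_iff hc]
    simp only [det, Prod.fst_add, Prod.snd_add, Prod.smul_fst, Prod.smul_snd, smul_eq_mul] at *
    linear_combination c * u t * this

/-! ### The Lax representation of the flows -/

/-- The coefficient `Φⱼ` of the linear equation `∂ψ/∂s = Φⱼ ψ' - (1/2) Φⱼ' ψ`, which is compatible
with `ψ'' = (p + l) ψ` along the flow of `X_j`; explicitly `Φⱼ = ∑ (-2 l)ⁱ f_{j-i}`. -/
def laxCoeff (p : ℝ → ℝ) (l : ℝ) : ℕ → ℝ → ℝ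
  | 0 => fun _ => 1
  | n + 1 => fun t => -2 * l * laxCoeff p l n t + kdvPoly p (n + 1) t

theorem laxCoeff_smoothOn {S : Set ℝ} (hS : IsOpen S) {p : ℝ → ℝ → ℝ} (hp : SmoothOn S p) (l : ℝ)
    (n : ℕ) : SmoothOn S fun s t => laxCoeff (p s) l n t := by
  induction n with
  | zero => exact contDiffOn_const
  | succ n ih => exact ContDiffOn.add (contDiffOn_const.mul ih) (kdvPoly_smoothOn hS hp (n + 1))

theorem laxCoeff_contDiff {p : ℝ → ℝ} (hp : ContDiff ℝ ∞ p) (l : ℝ) (n : ℕ) :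
    ContDiff ℝ ∞ (laxCoeff p l n) :=
  (laxCoeff_smoothOn isOpen_univ (SmoothOn.of_contDiff hp Set.univ) l n).contDiff_right isOpen_univ
    (Set.mem_univ 0)

theorem laxCoeff_periodic {p : ℝ → ℝ} {T : ℝ} (hp : ∀ t, p (t + T) = p t) (l : ℝ) (n : ℕ)
    (t : ℝ) : laxCoeff p l n (t + T) = laxCoeff p l n t := by
  induction n with
  | zero => rfl
  | succ n ih => simp only [laxCoeff, ih, kdvPoly_periodic hp (n + 1)]

theorem deriv_laxCoeff_succ {p : ℝ → ℝ} (hp : ContDiff ℝ ∞ p) (l : ℝ) (n : ℕ) :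
    deriv (laxCoeff p l (n + 1)) =
    fun t => -2 * l * deriv (laxCoeff p l n) t + deriv (kdvPoly p (n + 1)) t :=
  funext fun t => (((hasDerivAt_of_contDiff (laxCoeff_contDiff hp l n) t).const_mul
    (-2 * l)).fun_add (hasDerivAt_of_contDiff (kdvPoly_contDiff hp (n + 1)) t)).deriv

theorem deriv_deriv_laxCoeff_succ {p : ℝ → ℝ} (hp : ContDiff ℝ ∞ p) (l : ℝ) (n : ℕ) :
    deriv (deriv (laxCoeff p l (n + 1))) =
    fun t => -2 * l * deriv (deriv (laxCoeff p l n)) t + deriv (deriv (kdvPoly p (n + 1))) t := by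
  rw [deriv_laxCoeff_succ hp]
  exact funext fun t => (((hasDerivAt_of_contDiff (contDiff_deriv (laxCoeff_contDiff hp l n))
    t).const_mul (-2 * l)).fun_add
      (hasDerivAt_of_contDiff (contDiff_deriv (kdvPoly_contDiff hp (n + 1))) t)).deriv

theorem deriv_deriv_deriv_laxCoeff_succ {p : ℝ → ℝ} (hp : ContDiff ℝ ∞ p) (l : ℝ) (n : ℕ) :
    deriv (deriv (deriv (laxCoeff p l (n + 1)))) =
    fun t => -2 * l * deriv (deriv (deriv (laxCoeff p l n))) t
      + deriv (deriv (deriv (kdvPoly p (n + 1)))) t := by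
  rw [deriv_deriv_laxCoeff_succ hp]
  exact funext fun t => (((hasDerivAt_of_contDiff (contDiff_deriv (contDiff_deriv
    (laxCoeff_contDiff hp l n))) t).const_mul (-2 * l)).fun_add (hasDerivAt_of_contDiff
      (contDiff_deriv (contDiff_deriv (kdvPoly_contDiff hp (n + 1)))) t)).deriv

/-- The compatibility condition of the Lax system along the flow of `X_n`. -/
theorem lenard_laxCoeff {p : ℝ → ℝ} (hp : ContDiff ℝ ∞ p) (l : ℝ) (n : ℕ) (t : ℝ) :
    lenard p (laxCoeff p l n) t + 2 * l * deriv (laxCoeff p l n) t = lenard p (kdvPoly p n) t := by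
  induction n with
  | zero => simp [laxCoeff, kdvPoly_zero, lenard]
  | succ n ih =>
    rw [← deriv_kdvPoly_succ hp] at ih
    simp only [lenard] at ih ⊢
    rw [deriv_deriv_deriv_laxCoeff_succ hp, deriv_laxCoeff_succ hp]
    simp only [laxCoeff]
    linear_combination -2 * l * ih

/-- The evolution of the slope, computed from the Lax representation, agrees with the one required
by `X_j`. -/
theorem laxCoeff_darboux {p q u : ℝ → ℝ} {l : ℝ} (hu : ContDiff ℝ ∞ u)
    (hp : p = fun t => u t ^ 2 - deriv u t - l) (hq : q = fun t => u t ^ 2 + deriv u t - l)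
    (n : ℕ) (t : ℝ) :
    deriv (deriv (laxCoeff p l n)) t + 2 * u t * deriv (laxCoeff p l n) t
        + 2 * deriv u t * laxCoeff p l n t =
      deriv (deriv (kdvPoly p n)) t + 2 * u t * deriv (kdvPoly p n) t
        + 2 * deriv u t * kdvPoly p n t - 2 * l * (kdvPoly q n t - kdvPoly p n t) := by
  have sp : ContDiff ℝ ∞ p := hp ▸ ((hu.pow 2).sub (contDiff_deriv hu)).sub contDiff_const
  induction n with
  | zero => simp [laxCoeff, kdvPoly_zero]
  | succ n ih =>
    rw [deriv_deriv_laxCoeff_succ sp, deriv_laxCoeff_succ sp, kdvPoly_darboux_succ hu hp hq]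
    simp only [laxCoeff]
    linear_combination -2 * l * ih

/-- The operator on `ℝ²` with a given matrix. -/
def matOp (a b c d : ℝ) : ℝ × ℝ →L[ℝ] ℝ × ℝ :=
  a • ((ContinuousLinearMap.fst ℝ ℝ ℝ).prod 0) + b • ((ContinuousLinearMap.snd ℝ ℝ ℝ).prod 0)
    + c • ((0 : ℝ × ℝ →L[ℝ] ℝ).prod (ContinuousLinearMap.fst ℝ ℝ ℝ))
    + d • ((0 : ℝ × ℝ →L[ℝ] ℝ).prod (ContinuousLinearMap.snd ℝ ℝ ℝ))

theorem matOp_apply (a b c d : ℝ) (x : ℝ × ℝ) :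
    matOp a b c d x = (a * x.1 + b * x.2, c * x.1 + d * x.2) := by
  ext <;> simp [matOp]

theorem SmoothOn.matOp {S : Set ℝ} {a b c d : ℝ → ℝ → ℝ} (ha : SmoothOn S a) (hb : SmoothOn S b)
    (hc : SmoothOn S c) (hd : SmoothOn S d) :
    SmoothOn S fun s t => matOp (a s t) (b s t) (c s t) (d s t) :=
  ((ContDiffOn.add ((ContDiffOn.smul ha contDiffOn_const).add (ContDiffOn.smul hb contDiffOn_const))
    (ContDiffOn.smul hc contDiffOn_const)).add (ContDiffOn.smul hd contDiffOn_const))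

theorem hasDerivAt_matOp {a b c d : ℝ → ℝ} {a' b' c' d' t : ℝ} (ha : HasDerivAt a a' t)
    (hb : HasDerivAt b b' t) (hc : HasDerivAt c c' t) (hd : HasDerivAt d d' t) :
    HasDerivAt (fun t => matOp (a t) (b t) (c t) (d t)) (matOp a' b' c' d') t := by
  unfold matOp
  exact (((ha.smul_const _).fun_add (hb.smul_const _)).fun_add (hc.smul_const _)).fun_add
    (hd.smul_const (F := ℝ × ℝ →L[ℝ] ℝ × ℝ) _)

/-- The Lax system `ψ'' = (p + l) ψ`, `∂ψ/∂s = Φ ψ' - (1/2) Φ' ψ` has a positive solution `ψ` that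
is multiplied by a constant `μ` under `t ↦ t + π` and has a prescribed slope `u = -ψ'/ψ` at `s₀`. The
last conjuncts are the equations for `u` that follow from the system. -/
theorem exists_lax_solution {S : Set ℝ} (hS : IsOpen S) (hS' : IsPreconnected S) {s₀ : ℝ}
    (h₀ : s₀ ∈ S) {p Φ : ℝ → ℝ → ℝ} (hp : SmoothOn S p) (hΦ : SmoothOn S Φ)
    (pp : ∀ s ∈ S, ∀ t, p s (t + Real.pi) = p s t)
    (pΦ : ∀ s ∈ S, ∀ t, Φ s (t + Real.pi) = Φ s t) {l : ℝ}
    (hps : ∀ s ∈ S, ∀ t, deriv (fun r => p r t) s = lenard (p s) (Φ s) t + 2 * l * deriv (Φ s) t)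
    {u₀ : ℝ → ℝ} (su₀ : ContDiff ℝ ∞ u₀) (pu₀ : ∀ t, u₀ (t + Real.pi) = u₀ t)
    (hu₀ : ∀ t, deriv u₀ t = u₀ t ^ 2 - l - p s₀ t) :
    ∃ (ψ u : ℝ → ℝ → ℝ) (μ : ℝ), SmoothOn S ψ ∧ SmoothOn S u ∧ (∀ t, u s₀ t = u₀ t) ∧
      0 < μ ∧ ∀ s ∈ S, ∀ t, 0 < ψ s t ∧ ψ s (t + Real.pi) = μ * ψ s t ∧
        HasDerivAt (ψ s) (-u s t * ψ s t) t ∧ u s (t + Real.pi) = u s t ∧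
        HasDerivAt (u s) (u s t ^ 2 - l - p s t) t ∧
        HasDerivAt (fun r => u r t) ((1 / 2) * (deriv (deriv (Φ s)) t + 2 * u s t * deriv (Φ s) t
          + 2 * (u s t ^ 2 - l - p s t) * Φ s t)) s := by
  have hΦ1 := hΦ.deriv_right hS
  have hΦ2 := hΦ1.deriv_right hS
  have sc {a : ℝ} : SmoothOn S fun _ _ => a := contDiffOn_const
  have spl : SmoothOn S fun s t => p s t + l := ContDiffOn.add hp contDiffOn_const
  obtain ⟨L, hL⟩ : ∃ L : ℝ → ℝ → ℝ × ℝ →L[ℝ] ℝ × ℝ, L = fun s t => matOp 0 1 (p s t + l) 0 :=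
    ⟨_, rfl⟩
  obtain ⟨M, hM⟩ : ∃ M : ℝ → ℝ → ℝ × ℝ →L[ℝ] ℝ × ℝ, M = fun s t =>
      matOp (-(1 / 2) * deriv (Φ s) t) (Φ s t)
        (-(1 / 2) * deriv (deriv (Φ s)) t + (p s t + l) * Φ s t) ((1 / 2) * deriv (Φ s) t) :=
    ⟨_, rfl⟩
  have sL : SmoothOn S L := hL ▸ sc.matOp sc spl sc
  have sM : SmoothOn S M := hM ▸ SmoothOn.matOp (ContDiffOn.mul contDiffOn_const hΦ1) hΦ
    (ContDiffOn.add (ContDiffOn.mul contDiffOn_const hΦ2) (ContDiffOn.mul spl hΦ))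
    (ContDiffOn.mul contDiffOn_const hΦ1)
  have hzc (s : ℝ) (hs : s ∈ S) (t : ℝ) : deriv (fun r => L r t) s + (L s t).comp (M s t) =
      deriv (M s) t + (M s t).comp (L s t) := by
    have dL := (hasDerivAt_matOp (hasDerivAt_const s (0 : ℝ)) (hasDerivAt_const s (1 : ℝ))
      ((hp.hasDerivAt_left hS hs t).add_const l) (hasDerivAt_const s (0 : ℝ))).deriv
    have d1 := hΦ1.hasDerivAt_right hS hs t
    have dM := (hasDerivAt_matOp (d1.const_mul (-(1 / 2))) (hΦ.hasDerivAt_right hS hs t)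
      (((hΦ2.hasDerivAt_right hS hs t).const_mul (-(1 / 2))).fun_add
        (((hp.hasDerivAt_right hS hs t).add_const l).fun_mul (hΦ.hasDerivAt_right hS hs t)))
      (d1.const_mul (1 / 2))).deriv
    have hps' := hps s hs t
    simp only [lenard] at hps'
    refine ContinuousLinearMap.ext fun x => ?_
    rw [hL, hM]
    simp only [add_apply, ContinuousLinearMap.comp_apply, dL, dM, matOp_apply, hps',
      Prod.mk_add_mk, Prod.mk.injEq]
    constructor <;> ring
  have s₀ψ (t : ℝ) : HasDerivAt (fun t => Real.exp (-∫ r in (0 : ℝ)..t, u₀ r))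
      (-u₀ t * Real.exp (-∫ r in (0 : ℝ)..t, u₀ r)) t := by
    have := ((su₀.continuous.integral_hasStrictDerivAt 0 t).hasDerivAt).fun_neg.exp
    exact this.congr_deriv (mul_comm _ _)
  obtain ⟨x₀, hx₀⟩ : ∃ x₀ : ℝ → ℝ × ℝ, x₀ = fun t => (Real.exp (-∫ r in (0 : ℝ)..t, u₀ r),
      -u₀ t * Real.exp (-∫ r in (0 : ℝ)..t, u₀ r)) := ⟨_, rfl⟩
  have dx₀ (t : ℝ) : HasDerivAt x₀ (L s₀ t (x₀ t)) t := by
    rw [hx₀, hL, matOp_apply]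
    refine ((s₀ψ t).prodMk ((hasDerivAt_of_contDiff su₀ t).fun_neg.fun_mul (s₀ψ t))).congr_deriv ?_
    rw [hu₀, Prod.mk.injEq]
    constructor <;> ring
  obtain ⟨x, hxs₀, cx, dxs⟩ := exists_linear_solution hS hS' h₀ (ContDiffOn.continuousOn sM)
    (continuous_iff_continuousAt.2 fun t => (dx₀ t).continuousAt)
  have hxs₀' : x s₀ = x₀ := funext hxs₀
  have dxt (s : ℝ) (hs : s ∈ S) (t : ℝ) : HasDerivAt (x s) (L s t (x s t)) t :=
    hasDerivAt_of_zero_curvature hS hS' h₀ sL sM hzc dxs (fun t => hxs₀' ▸ dx₀ t) hs t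
  have sx : SmoothOn S x := smoothOn_of_linear_system hS sL sM cx dxs dxt
  have cM (t : ℝ) : ContinuousOn (fun s => M s t) S :=
    continuous_slice (ContDiffOn.continuousOn sM) t
  -- the multiplier does not depend on `s`
  obtain ⟨μ, hμ⟩ : ∃ μ, μ = Real.exp (-∫ r in (0 : ℝ)..Real.pi, u₀ r) := ⟨_, rfl⟩
  have hμ0 : 0 < μ := hμ ▸ Real.exp_pos _
  have hx₀π (t : ℝ) : x₀ (t + Real.pi) = μ • x₀ t := by
    have e : Real.exp (-∫ r in (0 : ℝ)..(t + Real.pi), u₀ r) =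
        μ * Real.exp (-∫ r in (0 : ℝ)..t, u₀ r) := by
      have hi (a b : ℝ) : IntervalIntegrable u₀ MeasureTheory.volume a b :=
        su₀.continuous.intervalIntegrable a b
      have hper : ∫ r in t..(t + Real.pi), u₀ r = ∫ r in (0 : ℝ)..(0 + Real.pi), u₀ r :=
        Function.Periodic.intervalIntegral_add_eq (f := u₀) pu₀ t 0
      rw [zero_add] at hper
      rw [hμ, ← Real.exp_add, ← intervalIntegral.integral_add_adjacent_intervals (hi 0 t) (hi t _),
        hper]
      ring_nf
    rw [hx₀]
    ext
    · simpa using e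
    · simp only [e, pu₀, Prod.smul_mk, smul_eq_mul]
      ring
  have hxπ (s : ℝ) (hs : s ∈ S) (t : ℝ) : x s (t + Real.pi) = μ • x s t := by
    have hMπ (r : ℝ) (hr : r ∈ S) : M r (t + Real.pi) = M r t := by
      simp only [hM, pp r hr, pΦ r hr, deriv_periodic (pΦ r hr),
        deriv_periodic (deriv_periodic (pΦ r hr))]
    refine sub_eq_zero.1 (linear_solution_eq_zero hS' h₀ (cM t)
      (y := fun r => x r (t + Real.pi) - μ • x r t) (fun r hr => ?_) ?_ hs)
    · refine ((dxs r hr (t + Real.pi)).fun_sub ((dxs r hr t).const_smul μ)).congr_deriv ?_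
      rw [hMπ r hr, map_sub, map_smul]
    · simp only [hxs₀, hx₀π, sub_self]
  have hxne (s : ℝ) (hs : s ∈ S) (t : ℝ) : x s t ≠ 0 := fun h => by
    have h1 := linear_solution_eq_zero hS' hs (cM t) (fun r hr => dxs r hr t) h h₀
    rw [hxs₀, hx₀] at h1
    exact (Real.exp_pos _).ne' (congrArg Prod.fst h1)
  have dψt (s : ℝ) (hs : s ∈ S) (t : ℝ) : HasDerivAt (fun t => (x s t).1) (x s t).2 t := by
    have h1 := (dxt s hs t)
    rw [hL, matOp_apply] at h1
    exact ((ContinuousLinearMap.fst ℝ ℝ ℝ).hasFDerivAt.comp_hasDerivAt t h1).congr_deriv (by simp)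
  have dχt (s : ℝ) (hs : s ∈ S) (t : ℝ) :
      HasDerivAt (fun t => (x s t).2) ((p s t + l) * (x s t).1) t := by
    have h1 := (dxt s hs t)
    rw [hL, matOp_apply] at h1
    exact ((ContinuousLinearMap.snd ℝ ℝ ℝ).hasFDerivAt.comp_hasDerivAt t h1).congr_deriv (by simp)
  have dψs (s : ℝ) (hs : s ∈ S) (t : ℝ) : HasDerivAt (fun r => (x r t).1)
      (-(1 / 2) * deriv (Φ s) t * (x s t).1 + Φ s t * (x s t).2) s := by
    have h1 := (dxs s hs t)
    rw [hM, matOp_apply] at h1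
    exact ((ContinuousLinearMap.fst ℝ ℝ ℝ).hasFDerivAt.comp_hasDerivAt s h1)
  have dχs (s : ℝ) (hs : s ∈ S) (t : ℝ) : HasDerivAt (fun r => (x r t).2)
      ((-(1 / 2) * deriv (deriv (Φ s)) t + (p s t + l) * Φ s t) * (x s t).1
        + (1 / 2) * deriv (Φ s) t * (x s t).2) s := by
    have h1 := (dxs s hs t)
    rw [hM, matOp_apply] at h1
    exact ((ContinuousLinearMap.snd ℝ ℝ ℝ).hasFDerivAt.comp_hasDerivAt s h1)
  -- `ψ` remains positive, since a double zero would have to appear first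
  have hpos : S ⊆ {s | s ∈ S ∧ ∀ t, 0 < (x s t).1} := by
    refine hS'.subset_of_closure_inter_subset ?_ ⟨s₀, h₀, h₀, fun t => ?_⟩ ?_
    · rw [isOpen_iff_mem_nhds]
      rintro s ⟨hs, hst⟩
      have h1 : ∀ᶠ r in nhds s, ∀ t ∈ Set.Icc 0 Real.pi, 0 < (x r t).1 := by
        refine isCompact_Icc.eventually_forall_of_forall_eventually fun t _ => ?_
        have hc : ContinuousAt (fun y : ℝ × ℝ => (x y.1 y.2).1) (s, t) :=
          (cx.continuousAt ((isOpen_strip hS).mem_nhds ⟨hs, Set.mem_univ t⟩)).fst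
        exact hc.eventually_const_lt (hst t)
      filter_upwards [h1, hS.mem_nhds hs] with r hr hrS
      refine ⟨hrS, fun t => ?_⟩
      have hper : Function.Periodic (fun t => 0 < (x r t).1) Real.pi := fun t => by
        dsimp only
        rw [hxπ r hrS t, Prod.smul_fst, smul_eq_mul, mul_pos_iff_of_pos_left hμ0]
      obtain ⟨τ, hτ, e⟩ := hper.exists_mem_Ico₀ Real.pi_pos t
      exact e ▸ hr τ (Set.Ico_subset_Icc_self hτ)
    · rw [hxs₀, hx₀]
      exact Real.exp_pos _
    · rintro s ⟨hcl, hs⟩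
      have hnn (t : ℝ) : 0 ≤ (x s t).1 := by
        have hc : ContinuousAt (fun r => (x r t).1) s := (dψs s hs t).continuousAt
        by_contra hneg
        obtain ⟨r, hr1, hr2⟩ := mem_closure_iff_nhds.1 hcl _
          (hc.eventually_lt_const (not_le.1 hneg))
        exact lt_asymm hr1 (hr2.2 t)
      refine ⟨hs, fun t => lt_of_le_of_ne (hnn t) fun h => hxne s hs t ?_⟩
      have hmin : IsLocalMin (fun t => (x s t).1) t :=
        Filter.Eventually.of_forall fun τ => by
          dsimp only
          rw [← h]
          exact hnn τ
      exact Prod.ext h.symm (hmin.hasDerivAt_eq_zero (dψt s hs t))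
  have sψ : SmoothOn S fun s t => (x s t).1 := ContDiffOn.fst sx
  have sχ : SmoothOn S fun s t => (x s t).2 := ContDiffOn.snd sx
  refine ⟨fun s t => (x s t).1, fun s t => -(x s t).2 / (x s t).1, μ, sψ,
    ContDiffOn.div (ContDiffOn.neg sχ) sψ fun y hy => ((hpos hy.1).2 y.2).ne', fun t => ?_, hμ0,
    fun s hs t => ?_⟩
  · dsimp only
    rw [hxs₀, hx₀]
    have := Real.exp_ne_zero (-∫ r in (0 : ℝ)..t, u₀ r)
    field_simp
  have h0 := (hpos hs).2 t
  have hne := h0.ne'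
  refine ⟨h0, ?_, ?_, ?_, ?_, ?_⟩
  · dsimp only
    rw [hxπ s hs t, Prod.smul_fst, smul_eq_mul]
  · refine (dψt s hs t).congr_deriv ?_
    field_simp
  · dsimp only
    rw [hxπ s hs t, Prod.smul_fst, Prod.smul_snd, smul_eq_mul, smul_eq_mul, ← mul_neg,
      mul_div_mul_left _ _ hμ0.ne']
  · refine ((dχt s hs t).fun_neg.fun_div (dψt s hs t) hne).congr_deriv ?_
    field_simp
    ring
  · refine ((dχs s hs t).fun_neg.fun_div (dψs s hs t) hne).congr_deriv ?_
    field_simp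
    ring

/-! ### The flows commute with `T_c` -/

/-- The difference of two solutions of a Riccati equation satisfies `d' = (u + v) d`. -/
theorem riccati_sub_eq_zero {u v r : ℝ → ℝ} (hu : ∀ t, HasDerivAt u (u t ^ 2 - r t) t)
    (hv : ∀ t, HasDerivAt v (v t ^ 2 - r t) t) {t₀ : ℝ} (h : v t₀ - u t₀ = 0) (t : ℝ) :
    v t - u t = 0 := by
  have hc : Continuous fun t => (u t + v t) • ContinuousLinearMap.id ℝ ℝ :=
    ((continuous_iff_continuousAt.2 fun t => (hu t).continuousAt).add
      (continuous_iff_continuousAt.2 fun t => (hv t).continuousAt)).smul continuous_const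
  refine linear_solution_eq_zero (y := fun t => v t - u t) isPreconnected_univ
    (Set.mem_univ t₀) hc.continuousOn (fun t _ => ?_) h (Set.mem_univ t)
  refine ((hv t).fun_sub (hu t)).congr_deriv ?_
  simp only [smul_apply, ContinuousLinearMap.id_apply, smul_eq_mul]
  ring

/-- A second periodic solution `v` of the Riccati equation is determined by the first, `u`:
with `u = -ψ'/ψ`, the function `1 / ((v - u) ψ²)` has the derivative `-1 / ψ²`. -/
theorem riccati_periodic_sub {u v r ψ : ℝ → ℝ} {μ : ℝ}
    (hu : ∀ t, HasDerivAt u (u t ^ 2 - r t) t) (hv : ∀ t, HasDerivAt v (v t ^ 2 - r t) t)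
    (hψ : ∀ t, HasDerivAt ψ (-u t * ψ t) t) (hpos : ∀ t, 0 < ψ t) (hμ : 0 < μ)
    (pu : ∀ t, u (t + Real.pi) = u t) (pv : ∀ t, v (t + Real.pi) = v t)
    (pψ : ∀ t, ψ (t + Real.pi) = μ * ψ t) (h0 : v 0 - u 0 ≠ 0) :
    (v 0 - u 0) * ψ 0 ^ 2 * ∫ t in (0 : ℝ)..Real.pi, (ψ t ^ 2)⁻¹ = 1 - (μ ^ 2)⁻¹ := by
  have hne (t : ℝ) : v t - u t ≠ 0 := fun h => h0 (riccati_sub_eq_zero hu hv h 0)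
  have hψne (t : ℝ) : ψ t ≠ 0 := (hpos t).ne'
  have cψ : Continuous ψ := continuous_iff_continuousAt.2 fun t => (hψ t).continuousAt
  have hd (t : ℝ) : HasDerivAt (fun t => -((v t - u t) * ψ t ^ 2)⁻¹) (ψ t ^ 2)⁻¹ t := by
    refine ((((hv t).fun_sub (hu t)).fun_mul ((hψ t).fun_pow 2)).fun_inv
      (mul_ne_zero (hne t) (pow_ne_zero 2 (hψne t)))).fun_neg.congr_deriv ?_
    have h1 := hne t
    have h2 := hψne t
    field_simp
    ring
  have hint : ∫ t in (0 : ℝ)..Real.pi, (ψ t ^ 2)⁻¹ = _ :=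
    intervalIntegral.integral_eq_sub_of_hasDerivAt (fun t _ => hd t)
      (((cψ.pow 2).inv₀ fun t => pow_ne_zero 2 (hψne t)).intervalIntegrable _ _)
  have e1 := pu 0
  have e2 := pv 0
  have e3 := pψ 0
  rw [zero_add] at e1 e2 e3
  rw [hint, e1, e2, e3]
  have h2 := hψne 0
  field_simp
  ring

theorem eq_zero_of_continuousOn_pair {S : Set ℝ} (hS' : IsPreconnected S) {k : ℝ → ℝ} {κ : ℝ}
    (hk : ContinuousOn k S) (hval : ∀ s ∈ S, k s = 0 ∨ k s = κ) {s₀ : ℝ} (h₀ : s₀ ∈ S)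
    (hk₀ : k s₀ = 0) {s : ℝ} (hs : s ∈ S) : k s = 0 := by
  rcases hval s hs with h | h
  · exact h
  · have hsub := (hS'.image k hk).ordConnected.uIcc_subset ⟨s₀, h₀, hk₀⟩ ⟨s, hs, h⟩
    have hmem : κ / 2 ∈ Set.uIcc 0 κ := by
      rcases le_total 0 κ with h0 | h0
      · rw [Set.uIcc_of_le h0]
        constructor <;> linarith
      · rw [Set.uIcc_of_ge h0]
        constructor <;> linarith
    obtain ⟨r, hr, hr'⟩ := hsub hmem
    rcases hval r hr with h1 | h1 <;> linarith

/-- Along a trajectory of `X_j` the potential evolves by the KdV-type equation `∂p/∂s = L f_j`. -/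
theorem IsKdVTrajectory.deriv_potential {j : ℕ} {S : Set ℝ} {G : ℝ → ℝ → ℝ × ℝ} (hS : IsOpen S)
    (h : IsKdVTrajectory j S G) {s : ℝ} (hs : s ∈ S) (t : ℝ) :
    deriv (fun r => potential (G r) t) s =
      lenard (potential (G s)) (kdvPoly (potential (G s)) j) t := by
  obtain ⟨g, -, -, hV, hp⟩ := h.family.velocity hS hs
  have hfield (f : ℝ → ℝ) (t : ℝ) : det (G s t) (tangent (G s) f t) = f t := by
    have := (h.family.isCurve s hs).det_eq_one t
    simp only [tangent, det, Prod.fst_add, Prod.snd_add, Prod.smul_fst, Prod.smul_snd,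
      smul_eq_mul] at *
    linear_combination f t * this
  have hg : g = kdvPoly (potential (G s)) j := by
    ext t
    have e : kdvField j (G s) t = tangent (G s) g t :=
      (h.flow s hs t).deriv.symm.trans (congrFun hV t)
    rw [← hfield g t, ← e, kdvField, hfield]
  rw [hp, hg]

/-- The velocity of the image under `T_c` of a trajectory of `X_j`, if the slope evolves by the Lax
equation. -/
theorem IsKdVTrajectory.hasDerivAt_image {j : ℕ} {S : Set ℝ} {G : ℝ → ℝ → ℝ × ℝ} (hS : IsOpen S)
    (h : IsKdVTrajectory j S G) {c : ℝ} (hc : c ≠ 0) {u : ℝ → ℝ → ℝ} {s : ℝ} (hs : s ∈ S)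
    (him : IsImage c (G s) fun t => (c * u s t) • G s t + c • deriv (G s) t)
    (hslope : slope c (G s) (fun t => (c * u s t) • G s t + c • deriv (G s) t) = u s) (t : ℝ)
    (hu : HasDerivAt (fun r => u r t) ((1 / 2) *
      (deriv (deriv (laxCoeff (potential (G s)) (1 / c ^ 2) j)) t
        + 2 * u s t * deriv (laxCoeff (potential (G s)) (1 / c ^ 2) j) t
        + 2 * deriv (u s) t * laxCoeff (potential (G s)) (1 / c ^ 2) j t)) s) :
    HasDerivAt (fun r => (c * u r t) • G r t + c • deriv (G r) t)
      (kdvField j (fun t => (c * u s t) • G s t + c • deriv (G s) t) t) s := by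
  obtain ⟨D, hD⟩ : ∃ D : ℝ → ℝ × ℝ, D = fun t => (c * u s t) • G s t + c • deriv (G s) t :=
    ⟨_, rfl⟩
  rw [← hD] at him hslope ⊢
  have hG : SmoothOn S G := h.family.smooth
  have hΓ := him.left
  have su : ContDiff ℝ ∞ (u s) := hslope ▸ slope_contDiff him.left him.right
  have hpot := him.potential_left hc
  have hpotD := him.potential_right hc
  have hric := him.riccati hc t
  have hdD := him.deriv_eq hc t
  rw [hslope] at hpot hpotD hric hdD
  rw [laxCoeff_darboux su hpot hpotD] at hu
  have hf := hΓ.kdvPoly_contDiff j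
  have dG1 : HasDerivAt (fun r => deriv (G r) t)
      ((-(1 / 2) * deriv (deriv (kdvPoly (potential (G s)) j)) t
        + potential (G s) t * kdvPoly (potential (G s)) j t) • G s t
      + ((1 / 2) * deriv (kdvPoly (potential (G s)) j) t) • deriv (G s) t) s := by
    refine ((hG.deriv_right hS).hasDerivAt_left hS hs t).congr_deriv ?_
    rw [← hG.deriv_comm hS hs t, show (fun τ => deriv (fun r => G r τ) s) = kdvField j (G s) from
      funext fun τ => (h.flow s hs τ).deriv]
    exact (hΓ.hasDerivAt_tangent hf t).deriv
  refine (((hu.const_mul c).fun_smul (h.flow s hs t)).fun_add (dG1.const_smul c)).congr_deriv ?_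
  rw [kdvField, kdvField, tangent, tangent, hdD, deriv_kdvPoly_darboux su hpot hpotD,
    show D t = (c * u s t) • G s t + c • deriv (G s) t by rw [hD], hric]
  module

/-- Trajectories of `X_j` lift through `T_c`, uniquely among continuous choices of the image. -/
theorem exists_image_trajectory {c : ℝ} (hc : c ≠ 0) (j : ℕ) (S : Set ℝ) (G : ℝ → ℝ → ℝ × ℝ)
    (s₀ : ℝ) (Δ₀ : ℝ → ℝ × ℝ) (hS : IsOpen S) (hS' : IsPreconnected S) (h₀ : s₀ ∈ S)
    (hG : IsKdVTrajectory j S G) (hΔ : IsImage c (G s₀) Δ₀) :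
    ∃ D : ℝ → ℝ → ℝ × ℝ, IsKdVTrajectory j S D ∧ D s₀ = Δ₀ ∧
      (∀ s ∈ S, IsImage c (G s) (D s)) ∧
      ∀ D' : ℝ → ℝ → ℝ × ℝ, D' s₀ = Δ₀ → (∀ t, ContinuousOn (fun s => D' s t) S) →
        (∀ s ∈ S, IsImage c (G s) (D' s)) → ∀ s ∈ S, D' s = D s := by
  have hp := hG.family.smoothOn_potential hS
  have sG : SmoothOn S G := hG.family.smooth
  have pp (s : ℝ) (hs : s ∈ S) := (hG.family.isCurve s hs).potential_periodic
  obtain ⟨ψ, u, μ, sψ, su, hu₀, hμ, hall⟩ := exists_lax_solution hS hS' h₀ hp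
    (laxCoeff_smoothOn hS hp (1 / c ^ 2) j) pp
    (fun s hs => laxCoeff_periodic (pp s hs) _ j)
    (fun s hs t => by
      rw [hG.deriv_potential hS hs, lenard_laxCoeff (hp.contDiff_right hS hs)])
    (slope_contDiff (c := c) hΔ.left hΔ.right) (slope_periodic hΔ.left hΔ.right) (hΔ.riccati hc)
  choose hpos hψπ hψt huπ hut hus using hall
  have him (s : ℝ) (hs : s ∈ S) := isImage_of_riccati hc (hG.family.isCurve s hs)
    (su.contDiff_right hS hs) (huπ s hs) fun t => (hut s hs t).deriv
  obtain ⟨D, hD⟩ : ∃ D : ℝ → ℝ → ℝ × ℝ,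
      D = fun s t => (c * u s t) • G s t + c • deriv (G s) t := ⟨_, rfl⟩
  have hDs₀ : D s₀ = Δ₀ := by
    ext1 t
    rw [hΔ.eq_slope hc, hD]
    simp only [hu₀]
  have himD (s : ℝ) (hs : s ∈ S) : IsImage c (G s) (D s) := hD ▸ (him s hs).1
  refine ⟨D, ⟨⟨?_, fun s hs => (himD s hs).right⟩, fun s hs t => ?_⟩, hDs₀, himD, ?_⟩
  · rw [hD]
    exact ((contDiffOn_const.mul su).smul sG).add
      (ContDiffOn.const_smul c (sG.deriv_right hS))
  · rw [hD]
    refine hG.hasDerivAt_image hS hc hs (him s hs).1 (him s hs).2 t ?_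
    rw [(hut s hs t).deriv]
    exact hus s hs t
  intro D' hD's₀ cD' himD'
  have hric (s : ℝ) (hs : s ∈ S) (t : ℝ) : HasDerivAt (slope c (G s) (D' s))
      (slope c (G s) (D' s) t ^ 2 - (1 / c ^ 2 + potential (G s) t)) t := by
    refine (hasDerivAt_of_contDiff (slope_contDiff (himD' s hs).left (himD' s hs).right)
      t).congr_deriv ?_
    rw [(himD' s hs).riccati hc]
    ring
  have hric' (s : ℝ) (hs : s ∈ S) (t : ℝ) : HasDerivAt (u s)
      (u s t ^ 2 - (1 / c ^ 2 + potential (G s) t)) t :=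
    (hut s hs t).congr_deriv (by ring)
  -- `k` vanishes where `D' s = D s`, and takes one and the same value elsewhere
  obtain ⟨k, hk⟩ : ∃ k : ℝ → ℝ, k = fun s => (slope c (G s) (D' s) 0 - u s 0) * ψ s 0 ^ 2 *
      ∫ t in (0 : ℝ)..Real.pi, (ψ s t ^ 2)⁻¹ := ⟨_, rfl⟩
  have sJ : SmoothOn S fun s t => (ψ s t ^ 2)⁻¹ :=
    ContDiffOn.inv (ContDiffOn.pow sψ 2) fun y hy => pow_ne_zero 2 (hpos y.1 hy.1 y.2).ne'
  have ck : ContinuousOn k S := by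
    rw [hk]
    refine ((ContinuousOn.sub ?_ ?_).mul (ContinuousOn.pow ?_ 2)).mul fun s hs =>
      (hasDerivAt_intervalIntegral hS sJ hs 0 Real.pi).continuousAt.continuousWithinAt
    · have h1 := cD' 0
      have h2 : ContinuousOn (fun s => deriv (G s) 0) S :=
        continuous_slice (φ := fun s t => deriv (G s) t)
          (ContDiffOn.continuousOn (sG.deriv_right hS)) 0
      exact ((h1.fst.mul h2.snd).sub (h1.snd.mul h2.fst)).div_const c
    · exact continuous_slice (ContDiffOn.continuousOn su) 0
    · exact continuous_slice (ContDiffOn.continuousOn sψ) 0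
  have hval (s : ℝ) (hs : s ∈ S) : k s = 0 ∨ k s = 1 - (μ ^ 2)⁻¹ := by
    by_cases hd : slope c (G s) (D' s) 0 - u s 0 = 0
    · left
      simp only [hk, hd, zero_mul]
    · right
      rw [hk]
      exact riccati_periodic_sub (hric' s hs) (hric s hs) (hψt s hs) (hpos s hs) hμ (huπ s hs)
        (slope_periodic (himD' s hs).left (himD' s hs).right) (hψπ s hs) hd
  have hk₀ : k s₀ = 0 := by
    simp only [hk, hD's₀, hu₀, sub_self, zero_mul]
  intro s hs
  have hks := eq_zero_of_continuousOn_pair hS' ck hval h₀ hk₀ hs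
  have hJ : 0 < ∫ t in (0 : ℝ)..Real.pi, (ψ s t ^ 2)⁻¹ :=
    intervalIntegral.intervalIntegral_pos_of_pos
      ((sJ.contDiff_right hS hs).continuous.intervalIntegrable _ _)
      (fun t => inv_pos.2 (pow_pos (hpos s hs t) 2)) Real.pi_pos
  rw [hk] at hks
  have hd0 : slope c (G s) (D' s) 0 - u s 0 = 0 :=
    ((mul_eq_zero.1 hks).resolve_right hJ.ne' |> mul_eq_zero.1).resolve_right
      (pow_ne_zero 2 (hpos s hs 0).ne')
  ext1 t
  rw [(himD' s hs).eq_slope hc t, hD,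
    sub_eq_zero.1 (riccati_sub_eq_zero (hric' s hs) (hric s hs) hd0 t)]

end CentroAffine

end

theorem mainTheorem2 :
    -- the vector fields and the Hamiltonians satisfy the bi-Hamiltonian recursion
    (∀ Γ : ℝ → ℝ × ℝ, CentroAffine.IsCurve Γ → ∀ j : ℕ, 1 ≤ j →
      CentroAffine.HasDifferentialAt (CentroAffine.kdvHamiltonian j)
        (CentroAffine.bigOmega Γ (CentroAffine.kdvField (j - 1) Γ)) Γ ∧
      ∀ V : ℝ → ℝ × ℝ, CentroAffine.IsTangent Γ V →
        CentroAffine.bigOmega Γ (CentroAffine.kdvField (j - 1) Γ) V =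
          CentroAffine.omega (CentroAffine.kdvField j Γ) V) ∧
    ∀ c : ℝ, c ≠ 0 →
      -- the differential of `T_c` takes `X_j` to `X_j`
      (∀ Γ Δ : ℝ → ℝ × ℝ, CentroAffine.IsImage c Γ Δ → ∀ j : ℕ,
        CentroAffine.DifferentialRelated Γ Δ
          (CentroAffine.kdvField j Γ) (CentroAffine.kdvField j Δ)) ∧
      -- `T_c` commutes with the flow of `X_j`: it takes trajectories to trajectories
      (∀ (j : ℕ) (S : Set ℝ) (G : ℝ → ℝ → ℝ × ℝ) (s₀ : ℝ) (Δ₀ : ℝ → ℝ × ℝ),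
        IsOpen S → IsPreconnected S → s₀ ∈ S →
        CentroAffine.IsKdVTrajectory j S G → CentroAffine.IsImage c (G s₀) Δ₀ →
        ∃ D : ℝ → ℝ → ℝ × ℝ,
          CentroAffine.IsKdVTrajectory j S D ∧ D s₀ = Δ₀ ∧
          (∀ s ∈ S, CentroAffine.IsImage c (G s) (D s)) ∧
          -- `D` is the only continuous choice of the branch of `T_c` along `G`
          ∀ D' : ℝ → ℝ → ℝ × ℝ, D' s₀ = Δ₀ →
            (∀ t, ContinuousOn (fun s => D' s t) S) →
            (∀ s ∈ S, CentroAffine.IsImage c (G s) (D' s)) →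
            ∀ s ∈ S, D' s = D s) ∧
      -- `T_c` preserves the Hamiltonians
      (∀ Γ Δ : ℝ → ℝ × ℝ, CentroAffine.IsImage c Γ Δ → ∀ j : ℕ, 1 ≤ j →
        CentroAffine.kdvHamiltonian j Δ = CentroAffine.kdvHamiltonian j Γ) := by
  refine ⟨fun Γ hΓ j hj => ?_, fun c hc => ⟨fun Γ Δ h j => h.differentialRelated hc j,
    CentroAffine.exists_image_trajectory hc, fun Γ Δ h j _ => h.kdvHamiltonian_eq hc j⟩⟩
  obtain ⟨n, rfl⟩ := Nat.exists_eq_add_of_le' hj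
  exact ⟨CentroAffine.hasDifferentialAt_hamiltonian hΓ n,
    fun V hV => CentroAffine.bigOmega_kdvField_eq_omega hΓ n hV⟩
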